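/- Let $\mathbb K$ be $\mathbb R$, $\mathbb C$ or the quaternions $\mathbb H$, and let $\delta=1,2,4$ respectively be its real dimension. Let $\ell^m_{p;\mathbb K}$ be the right $\mathbb K$-linear space $\mathbb K^m$ of columns $x=(\xi_i)_{i=1}^m$ with the norm $\|x\|_p=\left(\sum_{i=1}^m|\xi_i|^p\right)^{1/p}$, and let $\langle x,y\rangle=\sum_{i=1}^m\bar\xi_i\eta_i$ for $x=(\xi_i)$, $y=(\eta_i)$. An isometric embedding $\ell^m_{2;\mathbb K}\to\ell^n_{p;\mathbb K}$ is a right $\mathbb K$-linear map that preserves the norm. Every right $\mathbb K$-linear map $\mathbb K^m\to\mathbb K^n$ has the form $y\mapsto(\langle u_k,y\rangle)_{k=1}^n$ with unique $u_1,\dots,u_n\in\mathbb K^m$; it is called irreducible if all $u_k$ are nonzero and any two of them, $u_i$ and $u_k$ with $i\neq k$, are linearly independent over $\mathbb K$. Let $N_{\mathbb R}(d,q)$ be the minimal $n$ such that an isometric embedding $\ell^d_{2;\mathbb R}\to\ell^n_{q;\mathbb R}$ exists. **Theorem.** Let $m\ge 2$ be an integer, let $p\ge 4$ be an even integer, and put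 $\nu_{\mathbb K}(p)=N_{\mathbb R}(\delta,2\lfloor p/4\rfloor)$. If there is an irreducible isometric embedding $\ell^{m-1}_{2;\mathbb K}\to\ell^{n}_{p;\mathbb K}$, then there is an irreducible isometric embedding $\ell^{m}_{2;\mathbb K}\to\ell^{n'}_{p;\mathbb K}$, where $$n'=\begin{cases}\nu_{\mathbb K}(p)\,(p/2+1)\,n, & p\equiv 2\pmod 4,\\ \nu_{\mathbb K}(p)\,\bigl((p/2)\,n+1\bigr), & p\equiv 0\pmod 4.\end{cases}$$ -/

import Mathlib

open scoped ENNReal MulOpposite Quaternion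

namespace ProjEmb

/-- The space `ℓ^m_{p;K}`: columns of length `m` over `K` with the norm `(∑ |ξᵢ|^p)^(1/p)`.
Its right `K`-linear structure is its `Kᵐᵒᵖ`-module structure. -/
abbrev Ell (p : ℝ≥0∞) (K : Type) (m : ℕ) : Type := PiLp p (fun _ : Fin m => K)

section

variable {K : Type} [NormedRing K]

/-- A right `K`-linear map `ℓ^m_{2;K} → ℓ^n_{p;K}` is an isometric embedding if it preserves
the norm. -/
def IsIsometricEmbedding {p : ℝ≥0∞} {m n : ℕ} (T : Ell 2 K m →ₗ[Kᵐᵒᵖ] Ell p K n) : Prop :=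
  ∀ y, ‖T y‖ = ‖y‖

/-- The inner product `⟨x, y⟩ = ∑ᵢ x̄ᵢ yᵢ`, conjugate linear on the left. -/
def innerProd [StarRing K] {m : ℕ} (x : Fin m → K) (y : Ell 2 K m) : K :=
  ∑ i, star (x i) * y i

/-- The vectors `u₁, …, uₙ ∈ K^m` such that `T y = (⟨u_k, y⟩)_k` (see `apply_eq_innerProd`). -/
def frameVector [StarRing K] {p : ℝ≥0∞} {m n : ℕ} (T : Ell 2 K m →ₗ[Kᵐᵒᵖ] Ell p K n)
    (k : Fin n) : Fin m → K :=
  fun i => star (T (WithLp.toLp 2 (Pi.single i 1)) k)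

theorem apply_eq_innerProd [StarRing K] {p : ℝ≥0∞} {m n : ℕ}
    (T : Ell 2 K m →ₗ[Kᵐᵒᵖ] Ell p K n) (y : Ell 2 K m) (k : Fin n) :
    T y k = innerProd (frameVector T k) y := by
  have hy : y = ∑ i, MulOpposite.op (y i) • (WithLp.toLp 2 (Pi.single i 1) : Ell 2 K m) := by
    ext j
    simp [Pi.single_apply]
  conv_lhs => rw [hy]
  simp [innerProd, frameVector]

/-- A map `y ↦ (⟨u_k, y⟩)_k` is irreducible if the `u_k` are nonzero and every two of them are
linearly independent over `K` (as elements of the right `K`-space `K^m`). -/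
def IsIrreducible [StarRing K] {p : ℝ≥0∞} {m n : ℕ} (T : Ell 2 K m →ₗ[Kᵐᵒᵖ] Ell p K n) : Prop :=
  (∀ k, frameVector T k ≠ 0) ∧
    ∀ i k, i ≠ k → LinearIndependent Kᵐᵒᵖ ![frameVector T i, frameVector T k]

end

/-- `N_K(m,p)`: the minimal `n` such that an isometric embedding `ℓ^m_{2;K} → ℓ^n_{p;K}` exists. -/
noncomputable def minDim (K : Type) [NormedRing K] (m p : ℕ) : ℕ :=
  sInf {n : ℕ | ∃ T : Ell 2 K m →ₗ[Kᵐᵒᵖ] Ell p K n, IsIsometricEmbedding T}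

/-- `ν_K(p) = N_ℝ(δ, 2[p/4])`, where `δ` is the real dimension of `K`. -/
noncomputable def nu (K : Type) [NormedRing K] [Module ℝ K] (p : ℕ) : ℕ :=
  minDim ℝ (Module.finrank ℝ K) (2 * (p / 4))

/-- The number `n'` for an even `p`. -/
noncomputable def newDim (K : Type) [NormedRing K] [Module ℝ K] (p n : ℕ) : ℕ :=
  if p % 4 = 2 then nu K p * (p / 2 + 1) * n else nu K p * (p / 2 * n + 1)

end ProjEmb

open Polynomial Finset

/-! Put `N = p / 2`. Up to positive weights, an embedding is a system `u k` with `∑ ρ_k |⟨u_k,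
x⟩|^(2N) = R ‖x‖^(2N)`. Split `y = (t, x)` with `t ∈ K`, and lift each `u k` to the columns `(star
(± c_s), √ξ u_k)` with unit `c_s ∈ K`. Since `|⟨·, y⟩|² = ξ |⟨u_k, x⟩|² + |t|² ± 2 √ξ Re(...)`,
averaging the `N`-th power over the sign leaves a polynomial in `ξ` of degree at most `N`,
`signAverage`.

Averaging over a design `c_s` on the unit sphere of `K`, exact for even powers of degree at most
`N`, makes its coefficients explicit by Chu–Vandermonde (`sum_mul_coeff_signAverage`). Frame
identities descend to all lower powers by applying the Laplacian (`sum_norm_sq_pow_eq`). Integration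
in `ξ` against the polar-coordinate density (`trigFunctional`) then cancels every rising factorial,
and the binomial theorem gives a multiple of `‖y‖^(2N)`
(`exists_sum_trigFunctional_signAverage_eq`).

The integral may be replaced by a positive quadrature rule exact up to degree `N`. For `N = 2r + 1`
Gauss quadrature has `r + 1` nodes, hence `ν n (N + 1)` columns. For `N = 2r` a rule with `r`
positive nodes and a mass at `0` suffices; all columns from `0` are proportional to the first basis
vector, and splitting their mass suitably gives exactly `ν` columns besides the `ν n N` others
(`HasUnitFrame.succ`). The design with `ν` points comes from a minimal real embedding, which is
automatically irreducible (`isIrreducible_of_forall_le`). -/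

/-! ### Gauss quadrature for positive functionals on the half-line. -/

theorem exists_orthogonal_monic (r : ℕ) (L : ℝ[X] →ₗ[ℝ] ℝ)
    (hsq : ∀ f : ℝ[X], f ≠ 0 → f.degree < r → 0 < L (f * f)) :
    ∃ q : ℝ[X], q.Monic ∧ q.natDegree = r ∧ ∀ f : ℝ[X], f.degree < r → L (q * f) = 0 := by
  let V := degreeLT ℝ r
  let B : V →ₗ[ℝ] Module.Dual ℝ V :=
    LinearMap.mk₂ ℝ (fun h f : V => L ((h : ℝ[X]) * f))
      (fun a b c => by simp [add_mul]) (fun a b c => by simp)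
      (fun a b c => by simp [mul_add]) (fun a b c => by simp)
  have hB : ∀ h f : V, B h f = L ((h : ℝ[X]) * f) := fun _ _ => rfl
  have : FiniteDimensional ℝ V := Module.Finite.of_basis (degreeLT.basis ℝ r)
  have hinj : Function.Injective B := by
    rw [injective_iff_map_eq_zero]
    intro h hh
    by_contra hne
    have h1 := hsq h (by simpa using hne) (mem_degreeLT.1 h.2)
    have h2 : B h h = 0 := by rw [hh]; rfl
    rw [hB] at h2
    exact h1.ne' h2
  have hsurj : Function.Surjective B :=
    (LinearMap.injective_iff_surjective_of_finrank_eq_finrank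
      (Subspace.dual_finrank_eq (K := ℝ) (V := V)).symm).1 hinj
  -- Orthogonality of `X ^ r + h` says `L (h * f) = -L (X ^ r * f)`; this is solvable for `h`
  -- because the form is positive definite on polynomials of degree below `r`.
  obtain ⟨h, hh⟩ := hsurj (-(L ∘ₗ LinearMap.mulLeft ℝ (X ^ r : ℝ[X]) ∘ₗ V.subtype))
  have hdeg : (h : ℝ[X]).degree < r := mem_degreeLT.1 h.2
  refine ⟨X ^ r + (h : ℝ[X]), monic_X_pow_add hdeg, ?_, fun f hf => ?_⟩
  · rw [natDegree_add_eq_left_of_degree_lt (by simpa using hdeg), natDegree_X_pow]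
  · have := congrArg (fun φ => φ ⟨f, mem_degreeLT.2 hf⟩) hh
    simp only [hB] at this
    rw [add_mul, map_add, this]
    simp

section

variable {r : ℕ} {L : ℝ[X] →ₗ[ℝ] ℝ} {q : ℝ[X]}

/-- With quotient `g`, orthogonality gives `0 = L (q g) = L (((X - b) g)²) + c² L (g²)`, but the
first term is positive. The case `c ≠ 0` excludes nonreal roots and `c = 0` excludes multiple ones.
-/
theorem not_sq_add_sq_dvd_of_orthogonal
    (hsq : ∀ f : ℝ[X], f ≠ 0 → f.degree < r → 0 < L (f * f))
    (hq : q.Monic) (hqr : q.natDegree = r) (hort : ∀ f : ℝ[X], f.degree < r → L (q * f) = 0)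
    (b c : ℝ) : ¬ ((X - C b) ^ 2 + C (c ^ 2)) ∣ q := by
  rintro ⟨g, hg⟩
  have hd2 : (C (c ^ 2) : ℝ[X]).degree < ((X - C b) ^ 2 : ℝ[X]).degree := by
    rw [degree_pow, degree_X_sub_C]
    exact degree_C_le.trans_lt (by norm_num)
  have hw : ((X - C b) ^ 2 + C (c ^ 2) : ℝ[X]).Monic :=
    ((monic_X_sub_C b).pow 2).add_of_left hd2
  have hwd : ((X - C b) ^ 2 + C (c ^ 2) : ℝ[X]).natDegree = 2 := by
    rw [natDegree_add_eq_left_of_degree_lt hd2, natDegree_pow, natDegree_X_sub_C]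
  have hg0 : g ≠ 0 := by
    rintro rfl
    exact hq.ne_zero (by simpa using hg)
  have hdeg : g.natDegree + 2 = r := by
    rw [← hqr, hg, hw.natDegree_mul' hg0, hwd, add_comm]
  have h1 : ((X - C b) * g).degree < (r : WithBot ℕ) := by
    rw [degree_mul, degree_X_sub_C, degree_eq_natDegree hg0]
    norm_cast
    omega
  have h2 : g.degree < r := by
    rw [degree_eq_natDegree hg0]
    norm_cast
    omega
  have h3 := hsq _ (mul_ne_zero (X_sub_C_ne_zero b) hg0) h1
  have h4 := hsq _ hg0 h2
  have h5 := hort g h2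
  have h6 : q * g = ((X - C b) * g) * ((X - C b) * g) + (c ^ 2) • (g * g) := by
    rw [hg, smul_eq_C_mul]; ring
  rw [h6, map_add, map_smul, smul_eq_mul] at h5
  nlinarith [mul_nonneg (sq_nonneg c) h4.le]

theorem splits_of_orthogonal
    (hsq : ∀ f : ℝ[X], f ≠ 0 → f.degree < r → 0 < L (f * f))
    (hq : q.Monic) (hqr : q.natDegree = r) (hort : ∀ f : ℝ[X], f.degree < r → L (q * f) = 0) :
    q.Splits := by
  refine Splits.of_splits_map (algebraMap ℝ ℂ) (IsAlgClosed.splits _) fun z hz => ?_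
  by_cases him : z.im = 0
  · exact ⟨z.re, Complex.ext (by simp) (by simp [him])⟩
  · exfalso
    have hz0 : aeval z q = 0 := by
      rw [mem_roots', IsRoot, eval_map_algebraMap] at hz
      exact hz.2
    have := quadratic_dvd_of_aeval_eq_zero_im_ne_zero q hz0 him
    refine not_sq_add_sq_dvd_of_orthogonal hsq hq hqr hort z.re z.im ?_
    convert this using 1
    rw [← Complex.normSq_eq_norm_sq, Complex.normSq_apply]
    simp only [map_add, map_mul, map_pow, map_ofNat]
    ring

theorem nodup_roots_of_orthogonal
    (hsq : ∀ f : ℝ[X], f ≠ 0 → f.degree < r → 0 < L (f * f))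
    (hq : q.Monic) (hqr : q.natDegree = r) (hort : ∀ f : ℝ[X], f.degree < r → L (q * f) = 0) :
    q.roots.Nodup := by
  rw [Multiset.nodup_iff_count_le_one]
  intro a
  by_contra! h
  rw [count_roots] at h
  refine not_sq_add_sq_dvd_of_orthogonal hsq hq hqr hort a 0 ?_
  simpa using (le_rootMultiplicity_iff hq.ne_zero).1 h

/-- For `q = (X - a) g`, orthogonality reads `L (X g²) = a L (g²)`, and both values of `L` are
positive. -/
theorem pos_of_mem_roots_of_orthogonal
    (hsq : ∀ f : ℝ[X], f ≠ 0 → f.degree < r → 0 < L (f * f))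
    (hX : ∀ f : ℝ[X], f ≠ 0 → f.degree < r → 0 < L (X * (f * f)))
    (hq : q.Monic) (hqr : q.natDegree = r) (hort : ∀ f : ℝ[X], f.degree < r → L (q * f) = 0)
    {a : ℝ} (ha : a ∈ q.roots) : 0 < a := by
  obtain ⟨g, hg⟩ := dvd_iff_isRoot.2 (isRoot_of_mem_roots ha)
  have hg0 : g ≠ 0 := by
    rintro rfl
    exact hq.ne_zero (by simpa using hg)
  have hdeg : g.degree < r := by
    rw [degree_eq_natDegree hg0, ← hqr, hg, (monic_X_sub_C a).natDegree_mul' hg0,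
      natDegree_X_sub_C]
    norm_cast
    omega
  have h3 := hsq _ hg0 hdeg
  have h4 := hX _ hg0 hdeg
  have h5 := hort g hdeg
  have h6 : q * g = X * (g * g) - a • (g * g) := by
    rw [hg, smul_eq_C_mul]; ring
  rw [h6, map_sub, map_smul, smul_eq_mul] at h5
  by_contra! h
  nlinarith

/-- Gauss quadrature on the positive half-line with `r` nodes. -/
theorem exists_gauss_quadrature (r : ℕ) (L : ℝ[X] →ₗ[ℝ] ℝ)
    (hsq : ∀ f : ℝ[X], f ≠ 0 → f.degree < r → 0 < L (f * f))
    (hX : ∀ f : ℝ[X], f ≠ 0 → f.degree < r → 0 < L (X * (f * f))) :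
    ∃ (S : Finset ℝ) (w : ℝ → ℝ), S.card = r ∧ (∀ x ∈ S, 0 < x) ∧ (∀ x ∈ S, 0 < w x) ∧
      ∀ P : ℝ[X], P.degree < (2 * r : ℕ) → L P = ∑ x ∈ S, w x * P.eval x := by
  obtain ⟨q, hq, hqr, hort⟩ := exists_orthogonal_monic r L hsq
  have hsplit := splits_of_orthogonal hsq hq hqr hort
  have hnd := nodup_roots_of_orthogonal hsq hq hqr hort
  have hmem : ∀ x, x ∈ q.roots.toFinset ↔ x ∈ q.roots := fun x => Multiset.mem_toFinset
  have hcard : q.roots.toFinset.card = r := by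
    rw [Multiset.toFinset_card_of_nodup hnd, ← hsplit.natDegree_eq_card_roots, hqr]
  set S := q.roots.toFinset with hS
  have hinj : Set.InjOn (id : ℝ → ℝ) S := Function.injective_id.injOn
  set w : ℝ → ℝ := fun x => L (Lagrange.basis S id x) with hw
  have hexact : ∀ P : ℝ[X], P.degree < (2 * r : ℕ) → L P = ∑ x ∈ S, w x * P.eval x := by
    intro P hP
    -- Orthogonality kills the quotient part; the remainder agrees with `P` at the nodes and is
    -- recovered there by Lagrange interpolation.
    have hdecomp := modByMonic_add_div P q
    have hR : (P %ₘ q).degree < r := by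
      have := degree_modByMonic_lt P hq
      rwa [degree_eq_natDegree hq.ne_zero, hqr] at this
    have hdiv : (P /ₘ q).degree < r := by
      by_cases h0 : P /ₘ q = 0
      · rw [h0, degree_zero]; exact WithBot.bot_lt_coe _
      rw [degree_eq_natDegree h0, natDegree_divByMonic P hq, hqr]
      have hP0 : P ≠ 0 := by rintro rfl; simp at h0
      rw [degree_eq_natDegree hP0] at hP
      have hge : q.degree ≤ P.degree := by
        by_contra! hlt
        exact h0 ((divByMonic_eq_zero_iff hq).2 hlt)
      rw [degree_eq_natDegree hP0, degree_eq_natDegree hq.ne_zero, hqr] at hge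
      norm_cast at hP hge ⊢
      omega
    have hroot : ∀ x ∈ S, P.eval x = (P %ₘ q).eval x := by
      intro x hx
      conv_lhs => rw [← hdecomp]
      have : q.eval x = 0 := isRoot_of_mem_roots ((hmem x).1 hx)
      simp [this]
    have hL : L P = L (P %ₘ q) := by
      conv_lhs => rw [← hdecomp]
      rw [map_add, hort _ hdiv, add_zero]
    have hint := Lagrange.eq_interpolate (f := P %ₘ q) hinj (by rwa [hcard])
    rw [hL, hint, Lagrange.interpolate_apply, map_sum]
    refine sum_congr rfl fun x hx => ?_
    rw [← smul_eq_C_mul, map_smul, smul_eq_mul, mul_comm, hroot x hx, id]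
  refine ⟨S, w, hcard, fun x hx => pos_of_mem_roots_of_orthogonal hsq hX hq hqr hort
    ((hmem x).1 hx), fun x hx => ?_, hexact⟩
  -- Exactness on the squared Lagrange basis polynomial expresses its weight as `L` of a square.
  have hb0 := Lagrange.basis_ne_zero hinj hx
  have hr : 0 < r := hcard ▸ card_pos.2 ⟨x, hx⟩
  have hdeg : (Lagrange.basis S id x).degree < r := by
    rw [Lagrange.degree_basis hinj hx, hcard]
    norm_cast
    omega
  have h1 := hsq _ hb0 hdeg
  rw [hexact] at h1
  · rw [sum_eq_single_of_mem x hx] at h1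
    · have h2 := Lagrange.eval_basis_self hinj hx
      simp only [id] at h2
      simpa [h2] using h1
    · intro y hy hyx
      have h2 := Lagrange.eval_basis_of_ne (v := id) hyx.symm hy
      simp only [id] at h2
      simp [h2]
  · rw [degree_mul, degree_eq_natDegree hb0] at *
    norm_cast at *
    omega

end

/-- Moving a mass at `0` of a quadrature rule into the open half-line at the cost of one node. -/
theorem exists_quadrature_absorbing_zero {S : Finset ℝ} {w : ℝ → ℝ} (hS : ∀ x ∈ S, 0 < x)
    (hw : ∀ x ∈ S, 0 < w x) {η : ℝ} (hη : 0 < η) :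
    ∃ (S' : Finset ℝ) (w' : ℝ → ℝ), S'.card = S.card + 1 ∧ (∀ x ∈ S', 0 < x) ∧
      (∀ x ∈ S', 0 < w' x) ∧ ∀ P : ℝ[X], P.natDegree ≤ 2 * S.card →
        ∑ x ∈ S', w' x * P.eval x = ∑ x ∈ S, w x * P.eval x + η * P.eval 0 := by
  set r := S.card with hr
  -- The added coefficient is a mass at infinity: it is invisible in degree at most `2 * r`, yet
  -- contributes `(f.coeff r)²` to `L (X f²)`. This keeps the form definite when `f` of degree `r`
  -- vanishes on all of `S`, so Gauss quadrature with `r + 1` nodes applies.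
  let L : ℝ[X] →ₗ[ℝ] ℝ :=
    ∑ x ∈ S, w x • (aeval x).toLinearMap + η • (aeval (0 : ℝ)).toLinearMap + lcoeff ℝ (2 * r + 1)
  have hL : ∀ P : ℝ[X], L P = ∑ x ∈ S, w x * P.eval x + η * P.eval 0 + P.coeff (2 * r + 1) := by
    intro P
    simp [L, LinearMap.sum_apply, coe_aeval_eq_eval]
  have h0S : (0 : ℝ) ∉ S := fun h => (hS 0 h).false
  obtain ⟨S', w', h1, h2, h3, h4⟩ := exists_gauss_quadrature (r + 1) L
    (by
      intro f hf hdeg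
      have hnat : f.natDegree ≤ r := by
        rw [degree_eq_natDegree hf] at hdeg; norm_cast at hdeg; omega
      rw [hL, coeff_eq_zero_of_natDegree_lt (by
        have := natDegree_mul_le (p := f) (q := f); omega), add_zero]
      simp only [eval_mul]
      have hA : 0 ≤ ∑ x ∈ S, w x * (f.eval x * f.eval x) :=
        sum_nonneg fun x hx => mul_nonneg (hw x hx).le (mul_self_nonneg _)
      have hB : 0 ≤ η * (f.eval 0 * f.eval 0) := mul_nonneg hη.le (mul_self_nonneg _)
      refine lt_of_le_of_ne (by positivity) fun heq => hf ?_
      have hA0 : ∑ x ∈ S, w x * (f.eval x * f.eval x) = 0 := by linarith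
      have hB0 : η * (f.eval 0 * f.eval 0) = 0 := by linarith
      rw [sum_eq_zero_iff_of_nonneg fun x hx => mul_nonneg (hw x hx).le (mul_self_nonneg _)] at hA0
      refine eq_zero_of_degree_lt_of_eval_finset_eq_zero (insert 0 S) ?_ ?_
      · rwa [card_insert_of_notMem h0S]
      · intro x hx
        rcases mem_insert.1 hx with rfl | hx
        · simpa [hη.ne'] using hB0
        · simpa [(hw x hx).ne'] using hA0 x hx)
    (by
      intro f hf hdeg
      have hnat : f.natDegree ≤ r := by
        rw [degree_eq_natDegree hf] at hdeg; norm_cast at hdeg; omega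
      rw [hL, coeff_X_mul, two_mul, coeff_mul_add_eq_of_natDegree_le hnat hnat]
      simp only [eval_mul, eval_X, zero_mul, mul_zero, add_zero]
      have hnn : ∀ x ∈ S, 0 ≤ w x * (x * (f.eval x * f.eval x)) := fun x hx =>
        mul_nonneg (hw x hx).le (mul_nonneg (hS x hx).le (mul_self_nonneg _))
      have hA := sum_nonneg hnn
      have hB : 0 ≤ f.coeff r * f.coeff r := mul_self_nonneg _
      refine lt_of_le_of_ne (by positivity) fun heq => hf ?_
      have hA0 : ∑ x ∈ S, w x * (x * (f.eval x * f.eval x)) = 0 := by linarith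
      have hB0 : f.coeff r = 0 := mul_self_eq_zero.1 (by linarith)
      rw [sum_eq_zero_iff_of_nonneg hnn] at hA0
      refine eq_zero_of_degree_lt_of_eval_finset_eq_zero S ?_ ?_
      · rw [← hr, degree_lt_iff_coeff_zero]
        intro i hi
        rcases hi.eq_or_lt with rfl | hi
        · exact hB0
        · exact coeff_eq_zero_of_natDegree_lt (by omega)
      · intro x hx
        simpa [(hw x hx).ne', (hS x hx).ne'] using hA0 x hx)
  refine ⟨S', w', h1, h2, h3, fun P hP => ?_⟩
  rw [← h4 P (by
    refine degree_le_natDegree.trans_lt ?_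
    norm_cast
    omega), hL, coeff_eq_zero_of_natDegree_lt (by omega), add_zero]

/-! ### Rising factorials, trigonometric moments and radial quadrature rules. -/

/-- The rising factorial `x (x + 1) ⋯ (x + n - 1)`. -/
noncomputable def risingFactorial (x : ℝ) (n : ℕ) : ℝ := (ascPochhammer ℝ n).eval x

theorem risingFactorial_zero (x : ℝ) : risingFactorial x 0 = 1 := by simp [risingFactorial]

theorem risingFactorial_succ (x : ℝ) (n : ℕ) :
    risingFactorial x (n + 1) = risingFactorial x n * (x + n) := by
  simp [risingFactorial, ascPochhammer_succ_eval]

theorem risingFactorial_succ_left (x : ℝ) (n : ℕ) :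
    risingFactorial x (n + 1) = x * risingFactorial (x + 1) n := by
  simp [risingFactorial, ascPochhammer_succ_left]

theorem risingFactorial_pos {x : ℝ} (hx : 0 < x) (n : ℕ) : 0 < risingFactorial x n :=
  ascPochhammer_pos n x hx

theorem risingFactorial_add (x : ℝ) (m n : ℕ) :
    risingFactorial x (m + n) = risingFactorial x m * risingFactorial (x + m) n := by
  induction n with
  | zero => simp [risingFactorial_zero]
  | succ n ih =>
    rw [← add_assoc, risingFactorial_succ, ih, risingFactorial_succ]
    push_cast
    ring

section TrigMoments

/-- The integral of `sin ^ i * cos ^ j` over a quarter period. -/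
noncomputable def trigMoment (i j : ℕ) : ℝ :=
  ∫ θ in (0 : ℝ)..(Real.pi / 2), Real.sin θ ^ i * Real.cos θ ^ j

theorem trigMoment_pos (i j : ℕ) : 0 < trigMoment i j := by
  refine intervalIntegral.integral_pos (by positivity) (by fun_prop) (fun θ hθ => ?_)
    ⟨Real.pi / 4, ⟨by positivity, by linarith [Real.pi_pos]⟩, ?_⟩
  · exact mul_nonneg (pow_nonneg (Real.sin_nonneg_of_nonneg_of_le_pi hθ.1.le
      (by linarith [hθ.2, Real.pi_pos])) _) (pow_nonneg (Real.cos_nonneg_of_mem_Icc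
      ⟨by linarith [hθ.1, Real.pi_pos], hθ.2⟩) _)
  · rw [Real.sin_pi_div_four, Real.cos_pi_div_four]
    positivity

/-- Integration by parts: `sin ^ (i + 1) * cos ^ (j + 1)` vanishes at both ends of the quarter
period. -/
theorem trigMoment_recurrence (i j : ℕ) :
    (i + 1) * trigMoment i (j + 2) = (j + 1) * trigMoment (i + 2) j := by
  have hderiv : ∀ θ : ℝ, HasDerivAt (fun θ => Real.sin θ ^ (i + 1) * Real.cos θ ^ (j + 1))
      ((i + 1) * (Real.sin θ ^ i * Real.cos θ ^ (j + 2))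
        - (j + 1) * (Real.sin θ ^ (i + 2) * Real.cos θ ^ j)) θ := by
    intro θ
    refine (((Real.hasDerivAt_sin θ).pow (i + 1)).mul
      ((Real.hasDerivAt_cos θ).pow (j + 1))).congr_deriv ?_
    simp only [Nat.add_sub_cancel, Pi.pow_apply]
    push_cast
    ring
  have h := intervalIntegral.integral_eq_sub_of_hasDerivAt (a := 0) (b := Real.pi / 2)
    (fun θ _ => hderiv θ) (Continuous.intervalIntegrable (by fun_prop) _ _)
  rw [intervalIntegral.integral_sub (Continuous.intervalIntegrable (by fun_prop) _ _)
    (Continuous.intervalIntegrable (by fun_prop) _ _), intervalIntegral.integral_const_mul,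
    intervalIntegral.integral_const_mul] at h
  simp only [Real.sin_zero, Real.cos_pi_div_two, ne_eq, Nat.add_eq_zero_iff, one_ne_zero, and_false,
    not_false_eq_true, zero_pow, mul_zero, zero_mul, sub_zero] at h
  unfold trigMoment
  linarith

theorem trigMoment_eq (a b N : ℕ) {j : ℕ} (hj : j ≤ N) :
    trigMoment (a + 2 * j) (b + 2 * (N - j)) =
      trigMoment a (b + 2 * N) / risingFactorial ((b + 1 : ℝ) / 2) N *
        (risingFactorial ((a + 1 : ℝ) / 2) j * risingFactorial ((b + 1 : ℝ) / 2) (N - j)) := by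
  induction j with
  | zero =>
    have := (risingFactorial_pos (x := (b + 1 : ℝ) / 2) (by positivity) N).ne'
    simp only [risingFactorial_zero, mul_zero, add_zero, Nat.sub_zero]
    field_simp
  | succ j ih =>
    have ih := ih (by omega)
    obtain ⟨k, rfl⟩ : ∃ k, N = j + 1 + k := ⟨N - (j + 1), by omega⟩
    rw [show j + 1 + k - j = k + 1 by omega, risingFactorial_succ _ k] at ih
    rw [show j + 1 + k - (j + 1) = k by omega, risingFactorial_succ _ j]
    have h := trigMoment_recurrence (a + 2 * j) (b + 2 * k)
    rw [show b + 2 * k + 2 = b + 2 * (k + 1) by ring, ih,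
      show a + 2 * j + 2 = a + 2 * (j + 1) by ring] at h
    have hb : (0 : ℝ) < b + 2 * k + 1 := by positivity
    push_cast at h
    refine mul_left_cancel₀ hb.ne' (h.symm.trans ?_)
    ring

/-- The functional with moments `∫ sin ^ (a + 2 j) * cos ^ (b + 2 (N - j))`, `j ≤ N`. -/
noncomputable def trigFunctional (a b N : ℕ) : ℝ[X] →ₗ[ℝ] ℝ :=
  ∑ j ∈ range (N + 1), trigMoment (a + 2 * j) (b + 2 * (N - j)) • lcoeff ℝ j

theorem trigFunctional_apply (a b N : ℕ) (P : ℝ[X]) : trigFunctional a b N P =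
    ∑ j ∈ range (N + 1), trigMoment (a + 2 * j) (b + 2 * (N - j)) * P.coeff j := by
  simp [trigFunctional, LinearMap.sum_apply]

/-- For degree at most `N` the functional is the integral of `sin ^ a * cos ^ (b + 2 N) * P (tan²)`.
Only positive arguments of `P` occur, so the lemma covers `f²` as well as `X f²`. -/
theorem trigFunctional_pos (a b N : ℕ) {P : ℝ[X]} (hP : P ≠ 0) (hN : P.natDegree ≤ N)
    (hnn : ∀ x, 0 < x → 0 ≤ P.eval x) : 0 < trigFunctional a b N P := by
  set F : ℝ → ℝ := fun θ => ∑ j ∈ range (N + 1),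
    P.coeff j * (Real.sin θ ^ (a + 2 * j) * Real.cos θ ^ (b + 2 * (N - j))) with hF
  have hFc : Continuous F := by fun_prop
  have hint : trigFunctional a b N P = ∫ θ in (0 : ℝ)..(Real.pi / 2), F θ := by
    rw [trigFunctional_apply, hF, intervalIntegral.integral_finsetSum
      fun j _ => Continuous.intervalIntegrable (by fun_prop) _ _]
    refine sum_congr rfl fun j _ => ?_
    rw [intervalIntegral.integral_const_mul, trigMoment, mul_comm]
  have hFeq : ∀ θ ∈ Set.Ioo 0 (Real.pi / 2),
      F θ = Real.sin θ ^ a * Real.cos θ ^ (b + 2 * N) * P.eval (Real.tan θ ^ 2) := by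
    intro θ hθ
    have hc : Real.cos θ ≠ 0 := (Real.cos_pos_of_mem_Ioo
      ⟨by linarith [hθ.1, Real.pi_pos], hθ.2⟩).ne'
    rw [eval_eq_sum_range' (Nat.lt_succ_of_le hN), mul_sum]
    refine sum_congr rfl fun j hj => ?_
    have hj : j ≤ N := by rw [mem_range] at hj; omega
    rw [Real.tan_eq_sin_div_cos, ← pow_mul, div_pow]
    rw [show b + 2 * N = b + 2 * (N - j) + 2 * j by omega, pow_add _ (b + 2 * (N - j))]
    field_simp
    ring
  have hpos : ∀ θ ∈ Set.Ioo 0 (Real.pi / 2),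
      0 < Real.sin θ ^ a * Real.cos θ ^ (b + 2 * N) := fun θ hθ =>
    mul_pos (pow_pos (Real.sin_pos_of_pos_of_lt_pi hθ.1 (by linarith [hθ.2, Real.pi_pos])) _)
      (pow_pos (Real.cos_pos_of_mem_Ioo ⟨by linarith [hθ.1, Real.pi_pos], hθ.2⟩) _)
  have htan : ∀ θ ∈ Set.Ioo 0 (Real.pi / 2), 0 < Real.tan θ ^ 2 := fun θ hθ =>
    pow_pos (Real.tan_pos_of_pos_of_lt_pi_div_two hθ.1 hθ.2) 2
  have hF0 : ∀ θ ∈ Set.Icc 0 (Real.pi / 2), 0 ≤ F θ := by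
    have hcl : IsClosed {θ | 0 ≤ F θ} := isClosed_le continuous_const hFc
    have hsub : Set.Ioo 0 (Real.pi / 2) ⊆ {θ | 0 ≤ F θ} := fun θ hθ => by
      rw [Set.mem_ofPred_eq, hFeq θ hθ]
      exact mul_nonneg (hpos θ hθ).le (hnn _ (htan θ hθ))
    have := hcl.closure_subset_iff.2 hsub
    rwa [closure_Ioo (by positivity)] at this
  obtain ⟨x, hx0, hx⟩ : ∃ x : ℝ, 0 < x ∧ P.eval x ≠ 0 := by
    by_contra! h
    exact hP (eq_zero_of_infinite_isRoot P ((Set.Ioi_infinite (0 : ℝ)).mono fun x hx => h x hx))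
  rw [hint]
  have hθ : Real.arctan (√x) ∈ Set.Ioo 0 (Real.pi / 2) :=
    ⟨Real.arctan_pos.2 (Real.sqrt_pos.2 hx0), Real.arctan_lt_pi_div_two _⟩
  refine intervalIntegral.integral_pos (by positivity) hFc.continuousOn
    (fun θ hθ => hF0 θ (Set.Ioc_subset_Icc_self hθ))
    ⟨Real.arctan (√x), Set.Ioo_subset_Icc_self hθ, ?_⟩
  rw [hFeq _ hθ, Real.tan_arctan, Real.sq_sqrt hx0.le]
  exact mul_pos (hpos _ hθ) (lt_of_le_of_ne (hnn x hx0) hx.symm)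

end TrigMoments

theorem exists_trigFunctional_quadrature_odd (a b r : ℕ) :
    ∃ (S : Finset ℝ) (w : ℝ → ℝ), S.card = r + 1 ∧ (∀ x ∈ S, 0 < x) ∧ (∀ x ∈ S, 0 < w x) ∧
      ∀ P : ℝ[X], P.natDegree ≤ 2 * r + 1 →
        trigFunctional a b (2 * r + 1) P = ∑ x ∈ S, w x * P.eval x := by
  obtain ⟨S, w, h1, h2, h3, h4⟩ := exists_gauss_quadrature (r + 1) (trigFunctional a b (2 * r + 1))
    (fun f hf hdeg => trigFunctional_pos _ _ _ (mul_ne_zero hf hf)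
      (by
        rw [degree_eq_natDegree hf] at hdeg
        norm_cast at hdeg
        rw [natDegree_mul hf hf]
        omega)
      fun x _ => by rw [eval_mul]; exact mul_self_nonneg _)
    (fun f hf hdeg => trigFunctional_pos _ _ _ (mul_ne_zero X_ne_zero (mul_ne_zero hf hf))
      (by
        rw [degree_eq_natDegree hf] at hdeg
        norm_cast at hdeg
        rw [natDegree_mul X_ne_zero (mul_ne_zero hf hf), natDegree_mul hf hf, natDegree_X]
        omega)
      fun x hx => by
        rw [eval_mul, eval_mul, eval_X]
        exact mul_nonneg hx.le (mul_self_nonneg _))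
  refine ⟨S, w, h1, h2, h3, fun P hP => h4 P (degree_le_natDegree.trans_lt ?_)⟩
  norm_cast
  omega

/-- Gauss–Radau: Gauss quadrature for `P ↦ L (X P)`, with weights divided by the nodes, handles `P -
P(0)`. The defect on constants is the mass at `0`. -/
theorem exists_trigFunctional_quadrature_even (a b r : ℕ) :
    ∃ (S : Finset ℝ) (w : ℝ → ℝ) (η : ℝ), S.card = r ∧ (∀ x ∈ S, 0 < x) ∧ (∀ x ∈ S, 0 < w x) ∧
      0 < η ∧ ∀ P : ℝ[X], P.natDegree ≤ 2 * r →
        trigFunctional a b (2 * r) P = ∑ x ∈ S, w x * P.eval x + η * P.eval 0 := by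
  set L := trigFunctional a b (2 * r) with hL
  obtain ⟨S, w, h1, h2, h3, h4⟩ := exists_gauss_quadrature r (L ∘ₗ LinearMap.mulLeft ℝ (X : ℝ[X]))
    (fun f hf hdeg => trigFunctional_pos (P := X * (f * f)) _ _ _
      (mul_ne_zero X_ne_zero (mul_ne_zero hf hf))
      (by
        rw [degree_eq_natDegree hf] at hdeg
        norm_cast at hdeg
        rw [natDegree_mul X_ne_zero (mul_ne_zero hf hf), natDegree_mul hf hf, natDegree_X]
        omega)
      fun x hx => by
        rw [eval_mul, eval_mul, eval_X]
        exact mul_nonneg hx.le (mul_self_nonneg _))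
    (fun f hf hdeg => trigFunctional_pos (P := X * (X * (f * f))) _ _ _
      (mul_ne_zero X_ne_zero (mul_ne_zero X_ne_zero (mul_ne_zero hf hf)))
      (by
        rw [degree_eq_natDegree hf] at hdeg
        norm_cast at hdeg
        rw [natDegree_mul X_ne_zero (mul_ne_zero X_ne_zero (mul_ne_zero hf hf)),
          natDegree_mul X_ne_zero (mul_ne_zero hf hf), natDegree_mul hf hf, natDegree_X]
        omega)
      fun x hx => by
        rw [eval_mul, eval_mul, eval_mul, eval_X]
        exact mul_nonneg hx.le (mul_nonneg hx.le (mul_self_nonneg _)))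
  have key : ∀ P : ℝ[X], P.natDegree ≤ 2 * r →
      L P = ∑ x ∈ S, w x / x * P.eval x + (L 1 - ∑ x ∈ S, w x / x) * P.eval 0 := by
    intro P hP
    have hdecomp := divX_mul_X_add P
    have hLP : L P = L (X * divX P) + P.eval 0 * L 1 := by
      conv_lhs => rw [← hdecomp]
      rw [map_add, mul_comm, ← mul_one (C (P.coeff 0)), ← smul_eq_C_mul, map_smul, smul_eq_mul,
        coeff_zero_eq_eval_zero]
    have hLX : L (X * divX P) = ∑ x ∈ S, w x * (divX P).eval x := by
      by_cases h0 : divX P = 0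
      · simp [h0]
      · refine h4 _ ?_
        rw [degree_eq_natDegree h0, natDegree_divX_eq_natDegree_tsub_one]
        have : P.natDegree ≠ 0 := fun h => h0 (by rw [eq_C_of_natDegree_eq_zero h, divX_C])
        norm_cast
        omega
    rw [hLP, hLX, sub_mul, sum_mul, mul_comm (L 1), add_sub_assoc', add_comm _ (_ * L 1),
      add_comm _ (_ * L 1), add_sub_assoc, ← sum_sub_distrib]
    congr 1
    refine sum_congr rfl fun x hx => ?_
    have hx0 := (h2 x hx).ne'
    have : P.eval x = (divX P).eval x * x + P.eval 0 := by
      conv_lhs => rw [← hdecomp]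
      simp [coeff_zero_eq_eval_zero]
    rw [this]
    field_simp
    ring
  refine ⟨S, fun x => w x / x, L 1 - ∑ x ∈ S, w x / x, h1, h2,
    fun x hx => div_pos (h3 x hx) (h2 x hx), ?_, key⟩
  -- The squared nodal polynomial vanishes at all positive nodes, so it isolates the mass at `0` and
  -- shows that it is positive.
  set Q := Lagrange.nodal S (id : ℝ → ℝ) with hQ
  have hQ0 : Q ≠ 0 := Lagrange.nodal_ne_zero
  have hQd : (Q * Q).natDegree = 2 * r := by
    rw [natDegree_mul hQ0 hQ0, hQ, Lagrange.natDegree_nodal, h1]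
    ring
  have hpos : 0 < L (Q * Q) := trigFunctional_pos a b (2 * r) (mul_ne_zero hQ0 hQ0) hQd.le
    fun x _ => by rw [eval_mul]; exact mul_self_nonneg _
  rw [key _ hQd.le, sum_eq_zero fun x hx => by
    have := Lagrange.eval_nodal_at_node (v := (id : ℝ → ℝ)) hx
    simp only [id] at this
    simp [hQ, this], zero_add, eval_mul] at hpos
  exact pos_of_mul_pos_left hpos (mul_self_nonneg _)

/-! ### Chu–Vandermonde and the sign-averaged polynomial. -/

/-- A division-free Chu–Vandermonde. Both sides satisfy the same difference equation: passing from
`n` to `n + 1` at `j = i + 1` adds `i + 1` times the expression at `(β + 1, i, n)`. -/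
theorem sum_choose_mul_descFactorial_mul_risingFactorial (β : ℝ) (j n : ℕ) :
    ∑ l ∈ range (j + 1), (j.choose l : ℝ) * n.descFactorial l * risingFactorial (β + l) (j - l) =
      risingFactorial (β + n) j := by
  induction n generalizing β j with
  | zero =>
    rw [sum_range_succ', sum_eq_zero]
    · simp
    · intro l _
      simp
  | succ n ih =>
    cases j with
    | zero => simp [risingFactorial_zero]
    | succ i =>
      have h1 := ih β (i + 1)
      have h2 := ih (β + 1) i
      rw [sum_range_succ'] at h1 ⊢
      have hterm : ∀ k ∈ range (i + 1), ((i + 1).choose (k + 1) : ℝ) *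
          (n + 1).descFactorial (k + 1) * risingFactorial (β + (k + 1 : ℕ)) (i + 1 - (k + 1)) =
          ((i + 1).choose (k + 1) : ℝ) * n.descFactorial (k + 1) *
            risingFactorial (β + (k + 1 : ℕ)) (i + 1 - (k + 1)) +
          (i + 1) * ((i.choose k : ℝ) * n.descFactorial k *
            risingFactorial (β + 1 + k) (i - k)) := by
        intro k _
        have e1 : ((n + 1).descFactorial (k + 1) : ℝ) =
            n.descFactorial (k + 1) + (k + 1) * n.descFactorial k := by
          norm_cast
          rw [Nat.succ_descFactorial_succ, Nat.descFactorial_succ]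
          rcases le_or_gt k n with h | h
          · obtain ⟨d, rfl⟩ := Nat.exists_eq_add_of_le h
            simp only [Nat.add_sub_cancel_left]
            ring
          · simp [Nat.descFactorial_of_lt h]
        have e2 : ((i + 1).choose (k + 1) : ℝ) * (k + 1) = (i + 1) * i.choose k := by
          exact_mod_cast (Nat.add_one_mul_choose_eq i k).symm
        rw [e1, Nat.add_sub_add_right]
        have e3 : β + ((k + 1 : ℕ) : ℝ) = β + 1 + k := by push_cast; ring
        rw [e3]
        linear_combination (n.descFactorial k : ℝ) * risingFactorial (β + 1 + k) (i - k) * e2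
      rw [sum_congr rfl hterm, sum_add_distrib, ← mul_sum, h2]
      have e4 : risingFactorial (β + (n + 1 : ℕ)) (i + 1) =
          risingFactorial (β + n) (i + 1) + (i + 1) * risingFactorial (β + 1 + n) i := by
        rw [risingFactorial_succ, risingFactorial_succ_left]
        push_cast
        rw [show β + (n + 1 : ℝ) = β + 1 + n by ring, show β + (n : ℝ) + 1 = β + 1 + n by ring]
        ring
      rw [e4, ← h1]
      simp only [Nat.descFactorial_zero]
      ring

/-- The Chu–Vandermonde identity. -/
theorem sum_choose_mul_choose_mul_factorial_div {β : ℝ} (hβ : 0 < β) (j n : ℕ) :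
    ∑ l ∈ range (j + 1), (j.choose l : ℝ) * n.choose l * l.factorial / risingFactorial β l =
      risingFactorial β (n + j) / (risingFactorial β j * risingFactorial β n) := by
  have hj := (risingFactorial_pos hβ j).ne'
  have hn := (risingFactorial_pos hβ n).ne'
  rw [risingFactorial_add, ← sum_choose_mul_descFactorial_mul_risingFactorial, mul_comm
    (risingFactorial β j), mul_div_mul_left _ _ hn, sum_div]
  refine sum_congr rfl fun l hl => ?_
  obtain ⟨d, rfl⟩ := Nat.exists_eq_add_of_le (Nat.lt_succ_iff.1 (mem_range.1 hl))
  have hl := (risingFactorial_pos hβ l).ne'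
  have hd := (risingFactorial_pos (x := β + l) (by positivity) d).ne'
  rw [Nat.add_sub_cancel_left, risingFactorial_add, Nat.descFactorial_eq_factorial_mul_choose]
  push_cast
  field_simp

theorem four_pow_mul_risingFactorial_half (l : ℕ) :
    4 ^ l * risingFactorial (1 / 2) l * l.factorial = (2 * l).factorial := by
  induction l with
  | zero => simp [risingFactorial_zero]
  | succ l ih =>
    rw [risingFactorial_succ, Nat.factorial_succ, show 2 * (l + 1) = 2 * l + 1 + 1 by ring,
      Nat.factorial_succ, Nat.factorial_succ, pow_succ]
    push_cast
    rw [← ih]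
    ring

theorem coeff_C_mul_X_add_C_pow (a b : ℝ) (n i : ℕ) :
    ((C a * X + C b) ^ n).coeff i = a ^ i * b ^ (n - i) * n.choose i := by
  rw [add_pow, finsetSum_coeff]
  have : ∀ m, ((C a * X) ^ m * C b ^ (n - m) * (n.choose m : ℝ[X])).coeff i =
      if i = m then a ^ m * b ^ (n - m) * n.choose m else 0 := by
    intro m
    rw [mul_pow, ← C_pow, ← C_pow, ← C_eq_natCast, mul_right_comm, mul_assoc,
      mul_right_comm, ← mul_assoc, ← C_mul, ← C_mul,
      coeff_C_mul_X_pow]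
    split_ifs <;> ring
  simp only [this]
  rw [sum_ite_eq]
  split_ifs with h
  · rfl
  · rw [Nat.choose_eq_zero_of_lt (by rw [mem_range] at h; omega)]
    simp

theorem add_pow_add_sub_pow (A B : ℝ) (N : ℕ) :
    (A + B) ^ N + (A - B) ^ N =
      2 * ∑ l ∈ range (N / 2 + 1), (N.choose (2 * l) : ℝ) * A ^ (N - 2 * l) * (B ^ 2) ^ l := by
  have h1 : ∀ f : ℕ → ℝ, (∀ m, N < m → f m = 0) → (∀ m, Odd m → f m = 0) →
      ∑ m ∈ range (N + 1), f m = ∑ l ∈ range (N / 2 + 1), f (2 * l) := by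
    intro f hf hodd
    rw [← sum_image (g := fun l => 2 * l) (f := f) (by intro a _ b _ h; simpa using h)]
    refine (sum_subset ?_ ?_).symm
    · intro m hm
      simp only [mem_image, mem_range] at hm ⊢
      obtain ⟨l, hl, rfl⟩ := hm
      omega
    · intro m hm hm'
      refine hodd m (Nat.not_even_iff_odd.1 fun ⟨l, hl⟩ => hm' ?_)
      simp only [mem_image, mem_range] at hm ⊢
      exact ⟨l, by omega, by omega⟩
  rw [add_comm A, sub_eq_neg_add, add_pow, add_pow, ← sum_add_distrib, h1, mul_sum]
  · refine sum_congr rfl fun l _ => ?_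
    rw [pow_mul, pow_mul, neg_sq]
    ring
  · intro m hm
    simp [Nat.choose_eq_zero_of_lt hm]
  · intro m hm
    rw [hm.neg_pow]
    ring

/-- The polynomial in `x` that averages `(x a + b ± 2 √x h) ^ N` over the two signs, as a function
of `k = h ^ 2`. -/
noncomputable def signAverage (N : ℕ) (a b k : ℝ) : ℝ[X] :=
  ∑ l ∈ range (N / 2 + 1), (N.choose (2 * l) : ℝ) •
    ((C a * X + C b) ^ (N - 2 * l) * (C (4 * k) * X) ^ l)

theorem two_mul_eval_signAverage (N : ℕ) (a b h s : ℝ) :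
    2 * (signAverage N a b (h ^ 2)).eval (s ^ 2) =
      (s ^ 2 * a + b + 2 * s * h) ^ N + (s ^ 2 * a + b - 2 * s * h) ^ N := by
  rw [add_pow_add_sub_pow, signAverage, eval_finsetSum]
  congr 1
  refine sum_congr rfl fun l _ => ?_
  simp
  ring

theorem natDegree_signAverage_le (N : ℕ) (a b k : ℝ) : (signAverage N a b k).natDegree ≤ N := by
  refine natDegree_sum_le_of_forall_le _ _ fun l hl => (natDegree_smul_le _ _).trans
    (natDegree_mul_le.trans ?_)
  have h1 : ((C a * X + C b) ^ (N - 2 * l)).natDegree ≤ (N - 2 * l) * 1 :=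
    natDegree_pow_le_of_le _ natDegree_linear_le
  have h2 : ((C (4 * k) * X : ℝ[X]) ^ l).natDegree ≤ l * 1 :=
    natDegree_pow_le_of_le _ (by simpa using natDegree_C_mul_X_pow_le (4 * k) 1)
  rw [mem_range] at hl
  omega

/-- The value depends on neither `a` nor `k`; hence only the total mass at `0`, summed over the
frame and the design, will matter. -/
theorem eval_zero_signAverage (N : ℕ) (a b k : ℝ) : (signAverage N a b k).eval 0 = b ^ N := by
  rw [signAverage, eval_finsetSum, sum_range_succ', sum_eq_zero]
  · simp
  · intro l _
    simp

theorem coeff_signAverage (N : ℕ) (a b k : ℝ) (j : ℕ) : (signAverage N a b k).coeff j =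
    ∑ l ∈ range (N / 2 + 1), if l ≤ j then (N.choose (2 * l) : ℝ) * (4 * k) ^ l *
      (a ^ (j - l) * b ^ (N - 2 * l - (j - l)) * (N - 2 * l).choose (j - l)) else 0 := by
  rw [signAverage, finsetSum_coeff]
  refine sum_congr rfl fun l _ => ?_
  rw [coeff_smul, mul_pow, ← C_pow, mul_left_comm, coeff_C_mul, coeff_mul_X_pow']
  split_ifs
  · rw [coeff_C_mul_X_add_C_pow, smul_eq_mul]
    ring
  · simp

/-- With `u = j - l` and `v = N - j - l`, both sides equal `N! / (u! v!)`; if `N - j < l`, both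
vanish. -/
theorem choose_two_mul_mul_choose {N j l : ℕ} (hj : j ≤ N) (hl : l ≤ j) (hlN : 2 * l ≤ N) :
    (N.choose (2 * l) : ℝ) * (N - 2 * l).choose (j - l) * (2 * l).factorial =
      N.choose j * j.choose l * (N - j).choose l * l.factorial * l.factorial := by
  rcases le_or_gt l (N - j) with h | h
  · obtain ⟨u, rfl⟩ := Nat.exists_eq_add_of_le hl
    obtain ⟨v, rfl⟩ : ∃ v, N = l + u + (l + v) := ⟨N - (l + u) - l, by omega⟩
    have e0 : l + u + (l + v) - 2 * l = u + v := by omega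
    have e1 : l + u + (l + v) - (l + u) = l + v := by omega
    rw [e0, e1, Nat.add_sub_cancel_left]
    have f1 := Nat.choose_mul_factorial_mul_factorial (n := l + u + (l + v)) (k := 2 * l) (by omega)
    have f2 := Nat.choose_mul_factorial_mul_factorial (Nat.le_add_right u v)
    have f3 := Nat.choose_mul_factorial_mul_factorial (Nat.le_add_right (l + u) (l + v))
    have f4 := Nat.choose_mul_factorial_mul_factorial (Nat.le_add_right l u)
    have f5 := Nat.choose_mul_factorial_mul_factorial (Nat.le_add_right l v)
    rw [e0] at f1
    rw [Nat.add_sub_cancel_left] at f2 f3 f4 f5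
    have hu : (u.factorial : ℝ) ≠ 0 := by positivity
    have hv : (v.factorial : ℝ) ≠ 0 := by positivity
    refine mul_right_cancel₀ (mul_ne_zero hu hv) ?_
    norm_cast
    calc _ = (l + u + (l + v)).choose (2 * l) * (2 * l).factorial *
          ((u + v).choose u * u.factorial * v.factorial) := by ring
      _ = (l + u + (l + v)).choose (l + u) * ((l + u).choose l * l.factorial * u.factorial) *
          ((l + v).choose l * l.factorial * v.factorial) := by rw [f2, f4, f5, f1, f3]
      _ = _ := by ring
  · rw [Nat.choose_eq_zero_of_lt h, Nat.choose_eq_zero_of_lt (show N - 2 * l < j - l by omega)]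
    simp

/-- The factor `(1/2)_l` of the design moments cancels against `(2l)!` through
`four_pow_mul_risingFactorial_half`. What is left of the sum over `l` is the Chu–Vandermonde sum. -/
theorem sum_mul_coeff_signAverage {ι : Type*} [Fintype ι] (σ k : ι → ℝ) {N : ℕ} {a b κ β : ℝ}
    (hβ : 0 < β) (hk : ∀ l, 2 * l ≤ N → ∑ s, σ s * k s ^ l =
      κ * (risingFactorial (1 / 2) l / risingFactorial β l) * (a * b) ^ l) {j : ℕ} (hj : j ≤ N) :
    ∑ s, σ s * (signAverage N a b (k s)).coeff j =
      κ * (N.choose j * (risingFactorial β N / (risingFactorial β j * risingFactorial β (N - j))) *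
        (a ^ j * b ^ (N - j))) := by
  simp only [coeff_signAverage, mul_sum]
  rw [sum_comm]
  have hterm : ∀ l ∈ range (N / 2 + 1), (∑ s, σ s * if l ≤ j then (N.choose (2 * l) : ℝ) *
      (4 * k s) ^ l * (a ^ (j - l) * b ^ (N - 2 * l - (j - l)) * (N - 2 * l).choose (j - l)) else 0)
      = κ * (N.choose j * (a ^ j * b ^ (N - j))) *
        ((j.choose l : ℝ) * (N - j).choose l * l.factorial / risingFactorial β l) := by
    intro l hl
    have hlN : 2 * l ≤ N := by rw [mem_range] at hl; omega
    split_ifs with hlj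
    · have h1 : ∀ s, σ s * ((N.choose (2 * l) : ℝ) * (4 * k s) ^ l * (a ^ (j - l) *
          b ^ (N - 2 * l - (j - l)) * (N - 2 * l).choose (j - l))) =
          ((N.choose (2 * l) : ℝ) * 4 ^ l * (a ^ (j - l) *
          b ^ (N - 2 * l - (j - l)) * (N - 2 * l).choose (j - l))) * (σ s * k s ^ l) := by
        intro s
        rw [mul_pow]
        ring
      rw [sum_congr rfl fun s _ => h1 s, ← mul_sum, hk l hlN]
      have h2 := choose_two_mul_mul_choose hj hlj hlN
      rw [← four_pow_mul_risingFactorial_half] at h2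
      have h3 : (l.factorial : ℝ) ≠ 0 := by positivity
      have h4 : (N.choose (2 * l) : ℝ) * (N - 2 * l).choose (j - l) *
          (4 ^ l * risingFactorial (1 / 2) l) =
          N.choose j * j.choose l * (N - j).choose l * l.factorial :=
        mul_right_cancel₀ h3 (by linear_combination h2)
      rcases le_or_gt l (N - j) with h | h
      · have ea : a ^ j = a ^ (j - l) * a ^ l := by rw [← pow_add]; congr 1; omega
        have eb : b ^ (N - j) = b ^ (N - 2 * l - (j - l)) * b ^ l := by
          rw [← pow_add]; congr 1; omega
        rw [ea, eb, mul_pow]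
        have := (risingFactorial_pos hβ l).ne'
        field_simp
        linear_combination (κ * a ^ l * b ^ l * a ^ (j - l) * b ^ (N - 2 * l - (j - l))) * h4
      · rw [Nat.choose_eq_zero_of_lt h, Nat.choose_eq_zero_of_lt (show N - 2 * l < j - l by omega)]
        simp
    · rw [Nat.choose_eq_zero_of_lt (show j < l by omega)]
      simp
  -- Terms with `l > min j (N - j)` vanish and this minimum is at most `N / 2`, so the summation
  -- range may be changed to the one in Chu–Vandermonde.
  have hext : ∀ n, j ≤ n ∨ N - j ≤ n → ∑ l ∈ range (n + 1),
      ((j.choose l : ℝ) * (N - j).choose l * l.factorial / risingFactorial β l) =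
      ∑ l ∈ range (N + 1),
        ((j.choose l : ℝ) * (N - j).choose l * l.factorial / risingFactorial β l) := by
    intro n hn
    rcases le_total n N with hnN | hnN
    · refine sum_subset (range_subset_range.2 (by omega)) fun l _ hl => ?_
      rw [mem_range] at hl
      rcases hn with h | h
      · rw [Nat.choose_eq_zero_of_lt (show j < l by omega)]; simp
      · rw [Nat.choose_eq_zero_of_lt (show N - j < l by omega)]; simp
    · refine (sum_subset (range_subset_range.2 (by omega)) fun l _ hl => ?_).symm
      rw [mem_range] at hl
      rw [Nat.choose_eq_zero_of_lt (show j < l by omega)]; simp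
  rw [sum_congr rfl hterm, ← mul_sum, hext (N / 2) (by omega), ← hext j (Or.inl le_rfl),
    sum_choose_mul_choose_mul_factorial_div hβ, Nat.sub_add_cancel hj]
  ring

/-! ### Columns over the three algebras and their real inner product. -/

/-- Normed real division algebras with a conjugation whose norm comes from a real inner product and
in which multiplication by `star u` is adjoint to multiplication by `u`, on either side. -/
class IsHurwitzAlgebra (K : Type) [NormedDivisionRing K] [StarRing K] [InnerProductSpace ℝ K] :
    Prop where
  norm_star (a : K) : ‖star a‖ = ‖a‖
  star_smul (r : ℝ) (a : K) : star (r • a) = r • star a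
  smul_mul (r : ℝ) (a b : K) : (r • a) * b = r • (a * b)
  mul_smul (r : ℝ) (a b : K) : a * (r • b) = r • (a * b)
  inner_star_mul (a u b : K) : inner ℝ a (star u * b) = inner ℝ (u * a) b
  inner_mul (a b u : K) : inner ℝ a (b * u) = inner ℝ (a * star u) b

instance : IsHurwitzAlgebra ℝ where
  norm_star a := by simp
  star_smul r a := by simp
  smul_mul r a b := by simp [mul_assoc]
  mul_smul r a b := by simp; ring
  inner_star_mul a u b := by simp; ring
  inner_mul a b u := by simp; ring

instance : IsHurwitzAlgebra ℂ where
  norm_star a := by simp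
  star_smul r a := by simp
  smul_mul r a b := smul_mul_assoc r a b
  mul_smul r a b := mul_smul_comm r a b
  inner_star_mul a u b := by simp [Complex.inner]; ring
  inner_mul a b u := by simp [Complex.inner]; ring

instance : IsHurwitzAlgebra ℍ[ℝ] where
  norm_star a := by simp
  star_smul r a := by ext <;> simp
  smul_mul r a b := by simp
  mul_smul r a b := by simp
  inner_star_mul a u b := by simp [Quaternion.inner_def]; ring
  inner_mul a b u := by simp [Quaternion.inner_def]; ring

section

variable {K : Type} [NormedDivisionRing K]

/-- The squared Euclidean norm of a column. -/
def colNormSq {d : ℕ} (x : Fin d → K) : ℝ := ∑ i, ‖x i‖ ^ 2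

theorem colNormSq_single {d : ℕ} (i : Fin d) (b : K) :
    colNormSq (Pi.single i b) = ‖b‖ ^ 2 := by
  rw [colNormSq, Finset.sum_eq_single i] <;> simp +contextual

theorem colNormSq_pos {d : ℕ} {x : Fin d → K} (hx : x ≠ 0) : 0 < colNormSq x := by
  obtain ⟨i, hi⟩ := Function.ne_iff.1 hx
  exact sum_pos' (fun _ _ => sq_nonneg _) ⟨i, mem_univ i, pow_pos (norm_pos_iff.2 hi) 2⟩

theorem colNormSq_succ {d : ℕ} (y : Fin (d + 1) → K) :
    colNormSq y = ‖y 0‖ ^ 2 + colNormSq (Fin.tail y) := by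
  simp [colNormSq, Fin.sum_univ_succ, Fin.tail]

variable [InnerProductSpace ℝ K]

theorem colNormSq_smul {d : ℕ} (r : ℝ) (x : Fin d → K) :
    colNormSq (r • x) = r ^ 2 * colNormSq x := by
  simp [colNormSq, mul_sum, norm_smul, mul_pow]

theorem colNormSq_add_smul {d : ℕ} (x y : Fin d → K) (ε : ℝ) : colNormSq (x + ε • y) =
    colNormSq x + 2 * (∑ i, inner ℝ (x i) (y i)) * ε + colNormSq y * ε ^ 2 := by
  simp only [colNormSq, Pi.add_apply, Pi.smul_apply, norm_add_sq_real, inner_smul_right, norm_smul,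
    sum_add_distrib, mul_pow, Real.norm_eq_abs, sq_abs, ← mul_sum]
  ring

end

section

variable {K : Type} [NormedDivisionRing K] [StarRing K]

/-- The pairing `∑ i, star (u i) * y i` of columns. -/
def colInner {d : ℕ} (u y : Fin d → K) : K := ∑ i, star (u i) * y i

theorem colInner_single {d : ℕ} (u : Fin d → K) (i : Fin d) (b : K) :
    colInner u (Pi.single i b) = star (u i) * b := by
  rw [colInner, Finset.sum_eq_single i] <;> simp +contextual

theorem colInner_zero_left {d : ℕ} (y : Fin d → K) : colInner (0 : Fin d → K) y = 0 := by
  simp [colInner]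

theorem colInner_cons {d : ℕ} (c : K) (u : Fin d → K) (y : Fin (d + 1) → K) :
    colInner (Fin.cons c u : Fin (d + 1) → K) y = star c * y 0 + colInner u (Fin.tail y) := by
  simp [colInner, Fin.sum_univ_succ, Fin.tail]

theorem colInner_add {d : ℕ} (u x y : Fin d → K) :
    colInner u (x + y) = colInner u x + colInner u y := by
  simp [colInner, mul_add, sum_add_distrib]

variable [InnerProductSpace ℝ K] [IsHurwitzAlgebra K]

theorem colInner_smul {d : ℕ} (u : Fin d → K) (r : ℝ) (x : Fin d → K) :
    colInner u (r • x) = r • colInner u x := by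
  simp [colInner, smul_sum, IsHurwitzAlgebra.mul_smul]

theorem colInner_smul_left {d : ℕ} (u : Fin d → K) (r : ℝ) (x : Fin d → K) :
    colInner (r • u) x = r • colInner u x := by
  simp [colInner, smul_sum, IsHurwitzAlgebra.smul_mul, IsHurwitzAlgebra.star_smul]

theorem sum_norm_sq_colInner_single {d : ℕ} {κ : Type*} [Fintype κ] (b : OrthonormalBasis κ ℝ K)
    (u : Fin d → K) : ∑ i, ∑ a, ‖colInner u (Pi.single i (b a))‖ ^ 2 =
      Fintype.card κ * colNormSq u := by
  simp [colInner_single, IsHurwitzAlgebra.norm_star, colNormSq, mul_sum]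

/-- Adjointness moves `star (u i)` to the other side, and Parseval in each coordinate gives `‖u i *
z‖²`. -/
theorem sum_sq_inner_colInner_single {d : ℕ} {κ : Type*} [Fintype κ] (b : OrthonormalBasis κ ℝ K)
    (u : Fin d → K) (z : K) : ∑ i, ∑ a, (inner ℝ z (colInner u (Pi.single i (b a)))) ^ 2 =
      ‖z‖ ^ 2 * colNormSq u := by
  simp only [colInner_single, IsHurwitzAlgebra.inner_star_mul, colNormSq, mul_sum]
  refine sum_congr rfl fun i _ => ?_
  rw [b.sum_sq_inner_left, norm_mul, mul_pow, mul_comm]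

end

/-! ### Lower moments of a frame by the Laplacian. -/

theorem coeff_two_quadratic_pow (a b c : ℝ) (n : ℕ) :
    ((C a + C b * X + C c * X ^ 2) ^ (n + 1)).coeff 2 =
      (n + 1) * a ^ n * c + (n + 1) * n / 2 * a ^ (n - 1) * b ^ 2 := by
  have hmul : ∀ Q : ℝ[X], (C a + C b * X + C c * X ^ 2) * Q =
      C a * Q + C b * (X * Q) + C c * (X * (X * Q)) := fun Q => by ring
  have h0 : ∀ n, ((C a + C b * X + C c * X ^ 2) ^ n).coeff 0 = a ^ n := by
    intro n
    rw [coeff_zero_eq_eval_zero]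
    simp
  have h1 : ∀ n : ℕ, ((C a + C b * X + C c * X ^ 2) ^ n).coeff 1 = n * a ^ (n - 1) * b := by
    intro n
    induction n with
    | zero => simp [coeff_one]
    | succ n ih =>
      rw [pow_succ', hmul]
      simp only [coeff_add, coeff_C_mul, coeff_X_mul, ih, coeff_X_mul_zero, h0]
      cases n with
      | zero => simp
      | succ k => simp; ring
  induction n with
  | zero => simp
  | succ n ih =>
    rw [pow_succ', hmul]
    simp only [coeff_add, coeff_C_mul, coeff_X_mul, ih, h0, h1]
    cases n with
    | zero => simp; ring
    | succ k => simp; ring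

section

variable {K : Type} [NormedDivisionRing K] [StarRing K] [InnerProductSpace ℝ K]
  [IsHurwitzAlgebra K] [FiniteDimensional ℝ K]

/-- Applying the Laplacian to a power identity for unit vectors lowers the exponent by one. -/
theorem sum_norm_sq_pow_lower {ι : Type*} [Fintype ι] {d : ℕ} (u : ι → Fin d → K)
    (hu : ∀ k, colNormSq (u k) = 1) (w : ι → ℝ) (R : ℝ) (n : ℕ)
    (h : ∀ x, ∑ k, w k * (‖colInner (u k) x‖ ^ 2) ^ (n + 1) = R * colNormSq x ^ (n + 1))
    (x : Fin d → K) :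
    ((Module.finrank ℝ K : ℝ) / 2 + n) * ∑ k, w k * (‖colInner (u k) x‖ ^ 2) ^ n =
      R * (((Module.finrank ℝ K * d : ℕ) : ℝ) / 2 + n) * colNormSq x ^ n := by
  -- This compares the coefficients of `ε ^ 2` in the identity at `x + ε • y`, a second directional
  -- derivative. The truncated `n - 1` is harmless at `n = 0`, where its factor `n` vanishes.
  have hpoly : ∀ y, ∑ k, w k * ((n + 1) * (‖colInner (u k) x‖ ^ 2) ^ n * ‖colInner (u k) y‖ ^ 2 +
      (n + 1) * n / 2 * (‖colInner (u k) x‖ ^ 2) ^ (n - 1) *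
        (2 * inner ℝ (colInner (u k) x) (colInner (u k) y)) ^ 2) =
      R * ((n + 1) * colNormSq x ^ n * colNormSq y +
        (n + 1) * n / 2 * colNormSq x ^ (n - 1) * (2 * ∑ i, inner ℝ (x i) (y i)) ^ 2) := by
    intro y
    have hp : (∑ k, C (w k) * (C (‖colInner (u k) x‖ ^ 2) +
        C (2 * inner ℝ (colInner (u k) x) (colInner (u k) y)) * X +
        C (‖colInner (u k) y‖ ^ 2) * X ^ 2) ^ (n + 1)) =
        C R * (C (colNormSq x) + C (2 * ∑ i, inner ℝ (x i) (y i)) * X +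
          C (colNormSq y) * X ^ 2) ^ (n + 1) := by
      refine Polynomial.funext fun ε => ?_
      have := h (x + ε • y)
      rw [colNormSq_add_smul] at this
      simp only [eval_finsetSum, eval_mul, eval_C, eval_pow, eval_add, eval_X]
      rw [← this]
      refine sum_congr rfl fun k _ => ?_
      rw [colInner_add, colInner_smul, norm_add_sq_real, inner_smul_right, norm_smul, mul_pow,
        Real.norm_eq_abs, sq_abs]
      ring
    have := congrArg (fun p => p.coeff 2) hp
    simpa only [finsetSum_coeff, coeff_C_mul, coeff_two_quadratic_pow] using this
  -- Summing over the directions `Pi.single i (b a)`, a real orthonormal basis of `K^d`, turns the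
  -- second derivatives into the Laplacian.
  set b := stdOrthonormalBasis ℝ K
  have hsum : ∑ i : Fin d, ∑ a, ∑ k, w k * ((n + 1) * (‖colInner (u k) x‖ ^ 2) ^ n *
      ‖colInner (u k) (Pi.single i (b a))‖ ^ 2 +
      (n + 1) * n / 2 * (‖colInner (u k) x‖ ^ 2) ^ (n - 1) *
        (2 * inner ℝ (colInner (u k) x) (colInner (u k) (Pi.single i (b a)))) ^ 2) =
      ∑ i : Fin d, ∑ a, R * ((n + 1) * colNormSq x ^ n * colNormSq (Pi.single i (b a)) +
        (n + 1) * n / 2 * colNormSq x ^ (n - 1) *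
          (2 * ∑ j, inner ℝ (x j) ((Pi.single i (b a) : Fin d → K) j)) ^ 2) :=
    sum_congr rfl fun i _ => sum_congr rfl fun a _ => hpoly _
  have hL : ∀ k, ∑ i : Fin d, ∑ a, w k * ((n + 1) * (‖colInner (u k) x‖ ^ 2) ^ n *
      ‖colInner (u k) (Pi.single i (b a))‖ ^ 2 +
      (n + 1) * n / 2 * (‖colInner (u k) x‖ ^ 2) ^ (n - 1) *
        (2 * inner ℝ (colInner (u k) x) (colInner (u k) (Pi.single i (b a)))) ^ 2) =
      2 * (n + 1) * ((Module.finrank ℝ K : ℝ) / 2 + n) *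
        (w k * (‖colInner (u k) x‖ ^ 2) ^ n) := by
    intro k
    have e1 := sum_norm_sq_colInner_single b (u k)
    have e2 := sum_sq_inner_colInner_single b (u k) (colInner (u k) x)
    simp only [mul_pow, mul_add, sum_add_distrib, ← mul_sum]
    rw [e1, e2, hu, Fintype.card_fin]
    cases n with
    | zero => simp; ring
    | succ n => simp only [Nat.add_sub_cancel]; push_cast; ring
  have hR : ∑ i : Fin d, ∑ a, R * ((n + 1) * colNormSq x ^ n * colNormSq (Pi.single i (b a)) +
        (n + 1) * n / 2 * colNormSq x ^ (n - 1) *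
          (2 * ∑ j, inner ℝ (x j) ((Pi.single i (b a) : Fin d → K) j)) ^ 2) =
      2 * (n + 1) * (R * (((Module.finrank ℝ K * d : ℕ) : ℝ) / 2 + n) * colNormSq x ^ n) := by
    have e1 : ∑ i : Fin d, ∑ a, colNormSq (Pi.single i (b a) : Fin d → K) =
        (Module.finrank ℝ K * d : ℕ) := by
      simp [colNormSq_single, mul_comm]
    have e2 : ∑ i : Fin d, ∑ a, (∑ j, inner ℝ (x j) ((Pi.single i (b a) : Fin d → K) j)) ^ 2 =
        colNormSq x := by
      refine sum_congr rfl fun i _ => ?_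
      have : ∀ a, ∑ j, inner ℝ (x j) ((Pi.single i (b a) : Fin d → K) j) = inner ℝ (x i) (b a) := by
        intro a
        rw [Finset.sum_eq_single i] <;> simp +contextual
      simp only [this]
      exact b.sum_sq_inner_left (x i)
    simp only [mul_pow, mul_add, sum_add_distrib, ← mul_sum]
    rw [e1, e2]
    cases n with
    | zero => simp; ring
    | succ n => simp only [Nat.add_sub_cancel]; push_cast; ring
  have hswap : ∑ i : Fin d, ∑ a, ∑ k, w k * ((n + 1) * (‖colInner (u k) x‖ ^ 2) ^ n *
      ‖colInner (u k) (Pi.single i (b a))‖ ^ 2 +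
      (n + 1) * n / 2 * (‖colInner (u k) x‖ ^ 2) ^ (n - 1) *
        (2 * inner ℝ (colInner (u k) x) (colInner (u k) (Pi.single i (b a)))) ^ 2) =
      ∑ k, ∑ i : Fin d, ∑ a, w k * ((n + 1) * (‖colInner (u k) x‖ ^ 2) ^ n *
      ‖colInner (u k) (Pi.single i (b a))‖ ^ 2 +
      (n + 1) * n / 2 * (‖colInner (u k) x‖ ^ 2) ^ (n - 1) *
        (2 * inner ℝ (colInner (u k) x) (colInner (u k) (Pi.single i (b a)))) ^ 2) := by
    rw [sum_comm (s := univ (α := ι))]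
    exact sum_congr rfl fun i _ => sum_comm
  rw [hR, hswap, sum_congr rfl fun k _ => hL k, ← mul_sum] at hsum
  refine mul_left_cancel₀ (show (2 * ((n : ℝ) + 1)) ≠ 0 by positivity) ?_
  linear_combination hsum

/-- All moments of lower degree of a power identity for unit vectors. -/
theorem sum_norm_sq_pow_eq {ι : Type*} [Fintype ι] {d : ℕ} (hd : 0 < d) (u : ι → Fin d → K)
    (hu : ∀ k, colNormSq (u k) = 1) (w : ι → ℝ) {N : ℕ} (R : ℝ)
    (h : ∀ x, ∑ k, w k * (‖colInner (u k) x‖ ^ 2) ^ N = R * colNormSq x ^ N) {j : ℕ}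
    (hj : j ≤ N) (x : Fin d → K) :
    ∑ k, w k * (‖colInner (u k) x‖ ^ 2) ^ j =
      (R * (risingFactorial (((Module.finrank ℝ K * d : ℕ) : ℝ) / 2) N /
        risingFactorial ((Module.finrank ℝ K : ℝ) / 2) N)) *
      (risingFactorial ((Module.finrank ℝ K : ℝ) / 2) j /
        risingFactorial (((Module.finrank ℝ K * d : ℕ) : ℝ) / 2) j) * colNormSq x ^ j := by
  have hδ : 0 < Module.finrank ℝ K := Module.finrank_pos
  have hβ : 0 < (Module.finrank ℝ K : ℝ) / 2 := by positivity
  have hγ : 0 < ((Module.finrank ℝ K * d : ℕ) : ℝ) / 2 := by positivity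
  induction N generalizing R with
  | zero =>
    obtain rfl : j = 0 := by omega
    simpa [risingFactorial_zero] using h x
  | succ n ih =>
    have p1 := (risingFactorial_pos hβ n).ne'
    have p2 := (risingFactorial_pos hγ n).ne'
    have p3 : (Module.finrank ℝ K : ℝ) / 2 + n ≠ 0 := by positivity
    have p4 : ((Module.finrank ℝ K * d : ℕ) : ℝ) / 2 + n ≠ 0 := by positivity
    rcases hj.eq_or_lt with rfl | hj
    · rw [h x, risingFactorial_succ, risingFactorial_succ]
      field_simp
    · have hlow : ∀ x, ∑ k, w k * (‖colInner (u k) x‖ ^ 2) ^ n =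
          (R * (((Module.finrank ℝ K * d : ℕ) : ℝ) / 2 + n) / ((Module.finrank ℝ K : ℝ) / 2 + n)) *
            colNormSq x ^ n := by
        intro x
        have := sum_norm_sq_pow_lower u hu w R n h x
        field_simp at this ⊢
        linear_combination this
      rw [ih _ hlow (by omega), risingFactorial_succ, risingFactorial_succ]
      congr 2
      field_simp

end

/-! ### Unit frames, sphere designs and independence of lifted columns. -/

/-- Right linear independence of two columns. -/
def ColIndep {K : Type} [NormedDivisionRing K] {d : ℕ} (u v : Fin d → K) : Prop :=
  ∀ a b : K, (∀ i, u i * a + v i * b = 0) → a = 0 ∧ b = 0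

/-- A weighted system of `n` pairwise independent unit columns for which the weighted sum of the
`2 N`-th powers of the inner products is a multiple of the `2 N`-th power of the norm. -/
def HasUnitFrame (K : Type) [NormedDivisionRing K] [StarRing K] (d n N : ℕ) : Prop :=
  ∃ (ι : Type) (_ : Fintype ι) (u : ι → Fin d → K) (w : ι → ℝ) (R : ℝ), Fintype.card ι = n ∧
    0 < R ∧ (∀ k, colNormSq (u k) = 1) ∧ (∀ k, 0 < w k) ∧
    (∀ k l, k ≠ l → ColIndep (u k) (u l)) ∧
    ∀ x, ∑ k, w k * (‖colInner (u k) x‖ ^ 2) ^ N = R * colNormSq x ^ N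

/-- A weighted system of `ν` unit elements of `K`, no two of them equal up to sign, that integrates
even powers of degree at most `N` of real linear functionals over the unit sphere. -/
def HasSphereDesign (K : Type) [NormedDivisionRing K] [InnerProductSpace ℝ K] (ν N : ℕ) : Prop :=
  ∃ (ι : Type) (_ : Fintype ι) (c : ι → K) (σ : ι → ℝ) (W : ℝ), Fintype.card ι = ν ∧
    0 < W ∧ (∀ s, ‖c s‖ = 1) ∧ (∀ s, 0 < σ s) ∧
    (∀ s t, s ≠ t → c s ≠ c t ∧ c s ≠ -c t) ∧
    ∀ l, 2 * l ≤ N → ∀ v : K, ∑ s, σ s * (inner ℝ v (c s) ^ 2) ^ l =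
      W * (risingFactorial (1 / 2) l / risingFactorial ((Module.finrank ℝ K : ℝ) / 2) l) *
        (‖v‖ ^ 2) ^ l

section

variable {K : Type} [NormedDivisionRing K]

theorem ColIndep.symm {d : ℕ} {u v : Fin d → K} (h : ColIndep u v) : ColIndep v u :=
  fun a b hab => (h b a fun i => by rw [add_comm]; exact hab i).symm

theorem eq_zero_of_forall_mul_eq_zero {d : ℕ} {u : Fin d → K} (hu : u ≠ 0) {a : K}
    (h : ∀ i, u i * a = 0) : a = 0 := by
  obtain ⟨i, hi⟩ := Function.ne_iff.1 hu
  exact (mul_eq_zero.1 (h i)).resolve_left hi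

theorem ne_neg_self_of_norm_eq_one [NormedSpace ℝ K] {z : K} (hz : ‖z‖ = 1) : z ≠ -z := by
  intro h
  have h1 : (2 : ℝ) • z = 0 := by rw [two_smul]; nth_rewrite 2 [h]; exact add_neg_cancel z
  have h2 : z = 0 := (smul_eq_zero.1 h1).resolve_left two_ne_zero
  simp [h2] at hz

theorem cond_neg_ne [NormedSpace ℝ K] {κ : Type} {c : κ → K} (hc : ∀ s, ‖c s‖ = 1)
    (hcne : ∀ s t, s ≠ t → c s ≠ c t ∧ c s ≠ -c t) {s t : κ} {b b' : Bool}
    (hne : (s, b) ≠ (t, b')) : cond b (c s) (-c s) ≠ cond b' (c t) (-c t) := by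
  by_cases hst : s = t
  · subst hst
    have := ne_neg_self_of_norm_eq_one (hc s)
    cases b <;> cases b'
    · exact absurd rfl hne
    · exact this.symm
    · exact this
    · exact absurd rfl hne
  · obtain ⟨h1, h2⟩ := hcne s t hst
    cases b <;> cases b'
    · exact fun h => h1 (neg_injective h)
    · exact fun h => h2 (neg_eq_iff_eq_neg.1 h)
    · exact h2
    · exact h1

variable [StarRing K] [InnerProductSpace ℝ K] [IsHurwitzAlgebra K]

theorem ColIndep.smul {d : ℕ} {u v : Fin d → K} (h : ColIndep u v) {r s : ℝ} (hr : r ≠ 0)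
    (hs : s ≠ 0) : ColIndep (r • u) (s • v) := by
  intro a b hab
  have := h (r • a) (s • b) fun i => by
    have := hab i
    simpa [IsHurwitzAlgebra.smul_mul, IsHurwitzAlgebra.mul_smul] using this
  simpa [hr, hs] using this

theorem hasUnitFrame_of_ne_zero {ι : Type} [Fintype ι] {d N : ℕ} (u : ι → Fin d → K) (w : ι → ℝ)
    {R : ℝ} (hR : 0 < R) (hu : ∀ k, u k ≠ 0) (hw : ∀ k, 0 < w k)
    (hind : ∀ k l, k ≠ l → ColIndep (u k) (u l))
    (h : ∀ x, ∑ k, w k * (‖colInner (u k) x‖ ^ 2) ^ N = R * colNormSq x ^ N) :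
    HasUnitFrame K d (Fintype.card ι) N := by
  have hpos : ∀ k, 0 < colNormSq (u k) := fun k => colNormSq_pos (hu k)
  have hinv : ∀ k, (√(colNormSq (u k)))⁻¹ ≠ 0 := fun k =>
    inv_ne_zero (Real.sqrt_pos.2 (hpos k)).ne'
  refine ⟨ι, inferInstance, fun k => (√(colNormSq (u k)))⁻¹ • u k,
    fun k => w k * colNormSq (u k) ^ N, R, rfl, hR, fun k => ?_,
    fun k => mul_pos (hw k) (pow_pos (hpos k) _), fun k l hkl => (hind k l hkl).smul (hinv k) (hinv l),
    fun x => ?_⟩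
  · rw [colNormSq_smul, inv_pow, Real.sq_sqrt (hpos k).le, inv_mul_cancel₀ (hpos k).ne']
  · rw [← h x]
    refine sum_congr rfl fun k _ => ?_
    rw [colInner_smul_left, norm_smul, mul_pow, Real.norm_eq_abs, sq_abs, inv_pow,
      Real.sq_sqrt (hpos k).le, mul_pow, inv_pow]
    have := (pow_pos (hpos k) N).ne'
    field_simp

theorem colIndep_cons {d : ℕ} {u v : Fin d → K} (huv : ColIndep u v) {c c' : K} {r s : ℝ}
    (hr : r ≠ 0) (hs : s ≠ 0) :
    ColIndep (Fin.cons c (r • u) : Fin (d + 1) → K) (Fin.cons c' (s • v) : Fin (d + 1) → K) :=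
  fun a b hab => huv.smul hr hs a b fun i => by simpa using hab i.succ

/-- A relation forces `‖a‖ = ‖b‖` in the first coordinate and `r ‖a‖ = s ‖b‖` in the others. So a
nontrivial one has `r = s` and `b = -a`, whence `c = c'`. -/
theorem colIndep_cons_self {d : ℕ} {u : Fin d → K} (hu : u ≠ 0) {c c' : K} (hc : ‖c‖ = 1)
    (hc' : ‖c'‖ = 1) {r s : ℝ} (hr : 0 < r) (hs : 0 < s) (hne : r = s → c ≠ c') :
    ColIndep (Fin.cons c (r • u) : Fin (d + 1) → K) (Fin.cons c' (s • u) : Fin (d + 1) → K) := by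
  intro a b hab
  have h0 : c * a + c' * b = 0 := by simpa using hab 0
  have h1 : r • a + s • b = 0 := eq_zero_of_forall_mul_eq_zero hu fun i => by
    simpa [IsHurwitzAlgebra.smul_mul, IsHurwitzAlgebra.mul_smul, mul_add] using hab i.succ
  have hn : ‖a‖ = ‖b‖ := by
    have := congrArg norm (eq_neg_of_add_eq_zero_left h0)
    simpa [hc, hc'] using this
  have hn' : r * ‖a‖ = s * ‖b‖ := by
    have := congrArg norm (eq_neg_of_add_eq_zero_left h1)
    simpa [norm_smul, abs_of_pos hr, abs_of_pos hs] using this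
  by_cases ha : a = 0
  · exact ⟨ha, by simpa [ha, eq_comm] using hn⟩
  · exfalso
    have hrs : r = s := mul_right_cancel₀ (norm_ne_zero_iff.2 ha) (hn'.trans (by rw [hn]))
    subst hrs
    have hb : b = -a := by
      rw [← smul_add, smul_eq_zero] at h1
      exact (neg_eq_of_add_eq_zero_right (h1.resolve_left hr.ne')).symm
    rw [hb, mul_neg, ← sub_eq_add_neg, ← sub_mul, mul_eq_zero, sub_eq_zero] at h0
    exact hne rfl (h0.resolve_right ha)

theorem colIndep_cons_one_zero {d : ℕ} {u : Fin d → K} (hu : u ≠ 0) (c : K) {r : ℝ} (hr : r ≠ 0) :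
    ColIndep (Fin.cons c (r • u) : Fin (d + 1) → K) (Fin.cons 1 0 : Fin (d + 1) → K) := by
  intro a b hab
  have h1 : r • a = 0 := eq_zero_of_forall_mul_eq_zero hu fun i => by
    simpa [IsHurwitzAlgebra.smul_mul, IsHurwitzAlgebra.mul_smul, mul_add] using hab i.succ
  have ha : a = 0 := by simpa [hr] using h1
  exact ⟨ha, by simpa [ha] using hab 0⟩

/-- Adjointness rewrites the cross term as a real linear functional of `c`, which is what a sphere
design can average. -/
theorem norm_sq_colInner_cons {d : ℕ} (c : K) (hc : ‖c‖ = 1) (u : Fin d → K) (r : ℝ)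
    (y : Fin (d + 1) → K) : ‖colInner (Fin.cons (star c) (r • u) : Fin (d + 1) → K) y‖ ^ 2 =
      r ^ 2 * ‖colInner u (Fin.tail y)‖ ^ 2 + ‖y 0‖ ^ 2 +
        2 * r * inner ℝ (colInner u (Fin.tail y) * star (y 0)) c := by
  rw [colInner_cons, star_star, colInner_smul_left, norm_add_sq_real, inner_smul_right, norm_smul,
    norm_mul, hc, mul_pow ‖r‖, Real.norm_eq_abs, sq_abs, ← IsHurwitzAlgebra.inner_mul,
    real_inner_comm (colInner u (Fin.tail y))]
  ring

end

/-! ### From a frame in dimension `d` to one in dimension `d + 1`. -/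

section

variable {K : Type} [NormedDivisionRing K] [StarRing K] [InnerProductSpace ℝ K]
  [IsHurwitzAlgebra K] [FiniteDimensional ℝ K]

/-- The radial quadrature, the frame and the sphere design together average to a power of the
norm one dimension higher. -/
theorem exists_sum_trigFunctional_signAverage_eq {ι κ : Type} [Fintype ι] [Fintype κ] {d N : ℕ}
    (hd : 0 < d) (u : ι → Fin d → K) (ρ : ι → ℝ) {R : ℝ} (hR : 0 < R)
    (hu : ∀ k, colNormSq (u k) = 1)
    (hsum : ∀ x, ∑ k, ρ k * (‖colInner (u k) x‖ ^ 2) ^ N = R * colNormSq x ^ N)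
    (c : κ → K) (σ : κ → ℝ) {W : ℝ} (hW : 0 < W)
    (hdes : ∀ l, 2 * l ≤ N → ∀ v : K, ∑ s, σ s * (inner ℝ v (c s) ^ 2) ^ l =
      W * (risingFactorial (1 / 2) l / risingFactorial ((Module.finrank ℝ K : ℝ) / 2) l) *
        (‖v‖ ^ 2) ^ l) :
    ∃ C, 0 < C ∧ ∀ y : Fin (d + 1) → K, ∑ p : ι × κ, ρ p.1 * σ p.2 *
      trigFunctional (Module.finrank ℝ K * d - 1) (Module.finrank ℝ K - 1) N
        (signAverage N (‖colInner (u p.1) (Fin.tail y)‖ ^ 2) (‖y 0‖ ^ 2)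
          (inner ℝ (colInner (u p.1) (Fin.tail y) * star (y 0)) (c p.2) ^ 2)) =
      C * colNormSq y ^ N := by
  have hδ : 0 < Module.finrank ℝ K := Module.finrank_pos
  have hδd : 0 < Module.finrank ℝ K * d := Nat.mul_pos hδ hd
  set β : ℝ := (Module.finrank ℝ K : ℝ) / 2 with hβdef
  set γ : ℝ := ((Module.finrank ℝ K * d : ℕ) : ℝ) / 2 with hγdef
  have hβ : 0 < β := by positivity
  have hγ : 0 < γ := by positivity
  set a := Module.finrank ℝ K * d - 1 with ha
  set b := Module.finrank ℝ K - 1 with hb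
  have hbβ : ((b : ℝ) + 1) / 2 = β := by
    rw [hβdef, ← Nat.cast_add_one, hb, Nat.sub_add_cancel hδ]
  have haγ : ((a : ℝ) + 1) / 2 = γ := by
    rw [hγdef, ← Nat.cast_add_one, ha, Nat.sub_add_cancel hδd]
  set M := trigMoment a (b + 2 * N) / risingFactorial β N with hM
  have hMpos : 0 < M := div_pos (trigMoment_pos _ _) (risingFactorial_pos hβ N)
  have hL : ∀ P, trigFunctional a b N P = ∑ j ∈ range (N + 1),
      M * (risingFactorial γ j * risingFactorial β (N - j)) * P.coeff j := by
    intro P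
    rw [trigFunctional_apply]
    refine sum_congr rfl fun j hj => ?_
    rw [trigMoment_eq a b N (Nat.lt_succ_iff.1 (mem_range.1 hj)), hbβ, haγ]
  set R' := R * (risingFactorial γ N / risingFactorial β N) with hR'
  have hR'pos : 0 < R' := mul_pos hR (div_pos (risingFactorial_pos hγ N) (risingFactorial_pos hβ N))
  refine ⟨M * W * R' * risingFactorial β N, by
    have := risingFactorial_pos hβ N
    positivity, fun y => ?_⟩
  set x := Fin.tail y
  set t := y 0
  have hcoeff : ∀ k, ∀ j ≤ N, ∑ s, σ s * (signAverage N (‖colInner (u k) x‖ ^ 2) (‖t‖ ^ 2)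
      (inner ℝ (colInner (u k) x * star t) (c s) ^ 2)).coeff j =
      W * (N.choose j * (risingFactorial β N / (risingFactorial β j * risingFactorial β (N - j))) *
        ((‖colInner (u k) x‖ ^ 2) ^ j * (‖t‖ ^ 2) ^ (N - j))) := by
    intro k j hj
    refine sum_mul_coeff_signAverage σ _ hβ (fun l hl => ?_) hj
    rw [hdes l hl, norm_mul, IsHurwitzAlgebra.norm_star, mul_pow ‖colInner (u k) x‖]
  -- For each `j` the functional supplies `(γ)_j (β)_(N-j)`, the averaged coefficient `(β)_N /
  -- ((β)_j (β)_(N-j))`, and the frame moment `(β)_j / (γ)_j`. Only `(β)_N` survives, leaving the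
  -- binomial expansion.
  simp only [hL, mul_sum]
  rw [sum_comm, colNormSq_succ, add_comm (‖y 0‖ ^ 2), add_pow, mul_sum]
  refine sum_congr rfl fun j hj => ?_
  have hj : j ≤ N := Nat.lt_succ_iff.1 (mem_range.1 hj)
  rw [Fintype.sum_prod_type]
  have h1 : ∀ k, ∑ s, ρ k * σ s * (M * (risingFactorial γ j * risingFactorial β (N - j)) *
      (signAverage N (‖colInner (u k) x‖ ^ 2) (‖t‖ ^ 2)
        (inner ℝ (colInner (u k) x * star t) (c s) ^ 2)).coeff j) =
      M * W * risingFactorial β N * (N.choose j) * (risingFactorial γ j / risingFactorial β j) *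
        (‖t‖ ^ 2) ^ (N - j) * (ρ k * (‖colInner (u k) x‖ ^ 2) ^ j) := by
    intro k
    have h2 : ∀ s, ρ k * σ s * (M * (risingFactorial γ j * risingFactorial β (N - j)) *
        (signAverage N (‖colInner (u k) x‖ ^ 2) (‖t‖ ^ 2)
          (inner ℝ (colInner (u k) x * star t) (c s) ^ 2)).coeff j) =
        ρ k * (M * (risingFactorial γ j * risingFactorial β (N - j))) *
        (σ s * (signAverage N (‖colInner (u k) x‖ ^ 2) (‖t‖ ^ 2)
          (inner ℝ (colInner (u k) x * star t) (c s) ^ 2)).coeff j) := fun s => by ring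
    rw [sum_congr rfl fun s _ => h2 s, ← mul_sum, hcoeff k j hj]
    have p1 := (risingFactorial_pos hβ j).ne'
    have p2 := (risingFactorial_pos hβ (N - j)).ne'
    field_simp
  rw [sum_congr rfl fun k _ => h1 k, ← mul_sum, sum_norm_sq_pow_eq hd u hu ρ R hsum hj x]
  have p1 := (risingFactorial_pos hβ j).ne'
  have p2 := (risingFactorial_pos hγ j).ne'
  rw [← hβdef, ← hγdef, ← hR', show Fin.tail y = x from rfl, show y 0 = t from rfl]
  field_simp

/-- Assembling a frame in dimension `d + 1` from radial quadrature rules with nodes `S p`. -/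
theorem hasUnitFrame_succ_of_rules {ι κ : Type} [Fintype ι] [Fintype κ] {d N : ℕ}
    (hd : 0 < d) (u : ι → Fin d → K) (ρ : ι → ℝ) {R : ℝ} (hR : 0 < R)
    (hu : ∀ k, colNormSq (u k) = 1) (hρ : ∀ k, 0 < ρ k)
    (hind : ∀ k l, k ≠ l → ColIndep (u k) (u l))
    (hsum : ∀ x, ∑ k, ρ k * (‖colInner (u k) x‖ ^ 2) ^ N = R * colNormSq x ^ N)
    (c : κ → K) (σ : κ → ℝ) {W : ℝ} (hW : 0 < W) (hc : ∀ s, ‖c s‖ = 1) (hσ : ∀ s, 0 < σ s)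
    (hcne : ∀ s t, s ≠ t → c s ≠ c t ∧ c s ≠ -c t)
    (hdes : ∀ l, 2 * l ≤ N → ∀ v : K, ∑ s, σ s * (inner ℝ v (c s) ^ 2) ^ l =
      W * (risingFactorial (1 / 2) l / risingFactorial ((Module.finrank ℝ K : ℝ) / 2) l) *
        (‖v‖ ^ 2) ^ l)
    (S : ι × κ → Finset ℝ) (w : ι × κ → ℝ → ℝ) (η : ι × κ → ℝ)
    (hS : ∀ p, ∀ x ∈ S p, 0 < x) (hw : ∀ p, ∀ x ∈ S p, 0 < w p x)
    (hrule : ∀ p, ∀ P : ℝ[X], P.natDegree ≤ N →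
      trigFunctional (Module.finrank ℝ K * d - 1) (Module.finrank ℝ K - 1) N P =
        ∑ x ∈ S p, w p x * P.eval x + η p * P.eval 0)
    {e : ℕ} (he : e ≤ 1) {τ : ℝ} (hτ : 0 < τ) (hη : ∑ p, ρ p.1 * σ p.2 * η p = e * τ) :
    HasUnitFrame K (d + 1) (∑ p, 2 * (S p).card + e) N := by
  obtain ⟨C, hC, havg⟩ := exists_sum_trigFunctional_signAverage_eq hd u ρ hR hu hsum c σ hW hdes
  -- Each node yields two columns, one per sign, each with half the weight; the remaining mass at
  -- `0` is carried by at most one copy of the first basis vector.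
  let J := (Σ p : ι × κ, S p × Bool) ⊕ Fin e
  set sgn : Bool → K → K := fun b z => cond b z (-z)
  have hsgn : ∀ b s, ‖star (sgn b (c s))‖ = 1 := by
    intro b s
    cases b <;> simp [sgn, IsHurwitzAlgebra.norm_star, hc]
  let v : J → Fin (d + 1) → K := Sum.elim
    (fun q => Fin.cons (star (sgn q.2.2 (c q.1.2))) (√(q.2.1 : ℝ) • u q.1.1)) fun _ => Fin.cons 1 0
  let wt : J → ℝ := Sum.elim (fun q => ρ q.1.1 * σ q.1.2 * (w q.1 q.2.1 / 2)) fun _ => τ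
  have hune : ∀ k, u k ≠ 0 := by
    intro k h
    have := hu k
    simp [h, colNormSq] at this
  have hsqrt : ∀ (p : ι × κ) (x : S p), 0 < √(x : ℝ) := fun p x => Real.sqrt_pos.2 (hS p x x.2)
  have hsgn_ne : ∀ s t b b', (s, b) ≠ (t, b') → star (sgn b (c s)) ≠ star (sgn b' (c t)) :=
    fun s t b b' hne h => cond_neg_ne hc hcne hne (star_injective h)
  have hcard : Fintype.card J = ∑ p, 2 * (S p).card + e := by
    simp [J, mul_comm]
  rw [← hcard]
  refine hasUnitFrame_of_ne_zero v wt hC ?_ ?_ ?_ ?_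
  · rintro (⟨p, x, b⟩ | i) h
    · have h0 := congrFun h 0
      have := hsgn b p.2
      simp only [v, Sum.elim_inl, Fin.cons_zero, Pi.zero_apply] at h0
      rw [h0, norm_zero] at this
      exact zero_ne_one this
    · have h0 := congrFun h 0
      simp [v] at h0
  · rintro (⟨p, x, b⟩ | i)
    · exact mul_pos (mul_pos (hρ _) (hσ _)) (half_pos (hw p x x.2))
    · exact hτ
  · rintro (⟨p, x, b⟩ | i) (⟨p', x', b'⟩ | i') hne
    · obtain ⟨k, s⟩ := p
      obtain ⟨k', s'⟩ := p'
      -- Over different `u k` the last `d` coordinates already give independence; over the same one,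
      -- the node or the signed design point must differ.
      by_cases hk : k = k'
      · subst hk
        refine colIndep_cons_self (hune k) (hsgn _ _) (hsgn _ _) (hsqrt _ x) (hsqrt _ x')
          fun hxx => hsgn_ne _ _ _ _ fun heq => hne ?_
        obtain ⟨rfl, rfl⟩ := Prod.mk.inj heq
        have : x = x' := Subtype.ext
          ((Real.sqrt_inj (hS _ x x.2).le (hS _ x' x'.2).le).1 hxx)
        rw [this]
      · exact colIndep_cons (hind k k' hk) (hsqrt _ x).ne' (hsqrt _ x').ne'
    · exact colIndep_cons_one_zero (hune _) _ (hsqrt _ x).ne'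
    · exact (colIndep_cons_one_zero (hune _) _ (hsqrt _ x').ne').symm
    · exact absurd (congrArg Sum.inr (Fin.ext (by omega))) hne
  · intro y
    rw [← havg y, Fintype.sum_sum_type, Fintype.sum_sigma]
    have h1 : ∀ p : ι × κ, ∑ q : S p × Bool, wt (Sum.inl ⟨p, q⟩) *
        (‖colInner (v (Sum.inl ⟨p, q⟩)) y‖ ^ 2) ^ N = ρ p.1 * σ p.2 *
        ∑ x ∈ S p, w p x * (signAverage N (‖colInner (u p.1) (Fin.tail y)‖ ^ 2) (‖y 0‖ ^ 2)
          (inner ℝ (colInner (u p.1) (Fin.tail y) * star (y 0)) (c p.2) ^ 2)).eval x := by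
      intro p
      rw [Fintype.sum_prod_type, mul_sum]
      refine Eq.trans (sum_congr rfl fun x _ => ?_) (sum_coe_sort (S p) fun x => ρ p.1 * σ p.2 *
        (w p x * (signAverage N (‖colInner (u p.1) (Fin.tail y)‖ ^ 2) (‖y 0‖ ^ 2)
          (inner ℝ (colInner (u p.1) (Fin.tail y) * star (y 0)) (c p.2) ^ 2)).eval x))
      have hx : √(x : ℝ) ^ 2 = x := Real.sq_sqrt (hS p x x.2).le
      have h2 := two_mul_eval_signAverage N (‖colInner (u p.1) (Fin.tail y)‖ ^ 2) (‖y 0‖ ^ 2)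
        (inner ℝ (colInner (u p.1) (Fin.tail y) * star (y 0)) (c p.2)) (√(x : ℝ))
      rw [Fintype.sum_bool]
      simp only [v, wt, sgn, Sum.elim_inl, cond_true, cond_false]
      rw [norm_sq_colInner_cons _ (hc _), norm_sq_colInner_cons _ (by rw [norm_neg, hc]),
        inner_neg_right, mul_neg, ← sub_eq_add_neg]
      rw [hx] at h2 ⊢
      linear_combination (-(ρ p.1 * σ p.2 * (w p x / 2))) * h2
    have h3 : ∑ i : Fin e, wt (Sum.inr i) * (‖colInner (v (Sum.inr i)) y‖ ^ 2) ^ N =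
        e * τ * (‖y 0‖ ^ 2) ^ N := by
      simp [wt, v, colInner_cons, colInner_zero_left, mul_assoc]
    rw [sum_congr rfl fun p _ => h1 p, h3, ← hη, sum_mul, ← sum_add_distrib]
    refine sum_congr rfl fun p _ => ?_
    rw [hrule p _ (natDegree_signAverage_le _ _ _ _), eval_zero_signAverage]
    ring

end

section

variable {K : Type} [NormedDivisionRing K] [StarRing K] [InnerProductSpace ℝ K]
  [IsHurwitzAlgebra K] [FiniteDimensional ℝ K]

/-- For odd `N` the Gauss count is already right. For even `N` the Gauss–Radau rule with its mass at
`0` merged would give `ν N n + 1` columns, so that mass is redistributed to produce `ν` columns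
instead of one. -/
theorem HasUnitFrame.succ {d n ν N : ℕ} (hd : 0 < d) (hframe : HasUnitFrame K d n N)
    (hdesign : HasSphereDesign K ν N) :
    HasUnitFrame K (d + 1) (if N % 2 = 1 then ν * (N + 1) * n else ν * (N * n + 1)) N := by
  obtain ⟨ι, _, u, ρ, R, hn, hR, hu, hρ, hind, hsum⟩ := hframe
  obtain ⟨κ, _, c, σ, W, hν, hW, hc, hσ, hcne, hdes⟩ := hdesign
  have build := hasUnitFrame_succ_of_rules hd u ρ hR hu hρ hind hsum c σ hW hc hσ hcne hdes
  set a := Module.finrank ℝ K * d - 1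
  set b := Module.finrank ℝ K - 1
  split_ifs with hN
  · obtain ⟨r, rfl⟩ : ∃ r, N = 2 * r + 1 := ⟨N / 2, by omega⟩
    obtain ⟨S, w, hScard, hS, hw, hrule⟩ := exists_trigFunctional_quadrature_odd a b r
    have := build (fun _ => S) (fun _ => w) (fun _ => 0) (fun _ => hS) (fun _ => hw)
      (fun _ P hP => by rw [hrule P hP]; simp) (e := 0) (by omega) one_pos (by simp)
    convert this using 1
    simp [hScard, hn, hν]
    ring
  · obtain ⟨r, rfl⟩ : ∃ r, N = 2 * r := ⟨N / 2, by omega⟩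
    obtain ⟨S, w, η, hScard, hS, hw, hη, hrule⟩ := exists_trigFunctional_quadrature_even a b r
    have hιpos : 0 < n := by
      rw [← hn, Fintype.card_pos_iff]
      by_contra hempty
      rw [not_nonempty_iff] at hempty
      have h1 := hsum (Pi.single ⟨0, hd⟩ 1)
      rw [colNormSq_single] at h1
      simp at h1
      exact hR.ne' h1.symm
    have hκpos : 0 < ν := by
      rw [← hν, Fintype.card_pos_iff]
      by_contra hempty
      rw [not_nonempty_iff] at hempty
      have h1 := hdes 0 (Nat.zero_le _) 0
      simp [risingFactorial_zero] at h1
      exact hW.ne h1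
    have hle : ν / 2 ≤ (univ : Finset (ι × κ)).card := by
      rw [card_univ, Fintype.card_prod, hn, hν]
      calc ν / 2 ≤ 1 * ν := by omega
        _ ≤ n * ν := Nat.mul_le_mul_right _ hιpos
    -- On `ν / 2` of the pairs an extra node absorbs mass from `0` and adds two columns; if `ν` is
    -- odd, one column at `0` stays. Together these are `2 (ν / 2) + ν % 2 = ν` columns.
    obtain ⟨E, -, hE⟩ := exists_subset_card_eq hle
    classical
    set e := ν % 2 with he
    have hEe : 0 < ((ν / 2 : ℕ) : ℝ) + (e : ℝ) := by
      norm_cast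
      omega
    have hne : (univ : Finset (ι × κ)).Nonempty := by
      rw [← card_pos, card_univ, Fintype.card_prod, hn, hν]
      exact Nat.mul_pos hιpos hκpos
    have htot : 0 < ∑ p : ι × κ, ρ p.1 * σ p.2 :=
      sum_pos (fun p _ => mul_pos (hρ _) (hσ _)) hne
    -- The total mass at `0` is cut into equal shares `τ`, one for each pair in `E` and one for the
    -- column kept when `ν` is odd. A share may exceed the pair's own mass, leaving a negative
    -- residue; only the total enters.
    set τ := η * (∑ p : ι × κ, ρ p.1 * σ p.2) / (((ν / 2 : ℕ) : ℝ) + e) with hτ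
    have hτpos : 0 < τ := div_pos (mul_pos hη htot) hEe
    have hε : ∀ p : ι × κ, 0 < τ / (ρ p.1 * σ p.2) := fun p =>
      div_pos hτpos (mul_pos (hρ _) (hσ _))
    choose S' w' hS'card hS' hw' hrule' using fun p =>
      exists_quadrature_absorbing_zero hS hw (hε p)
    have := build (fun p => if p ∈ E then S' p else S) (fun p => if p ∈ E then w' p else w)
      (fun p => η - if p ∈ E then τ / (ρ p.1 * σ p.2) else 0)
      (fun p => by split_ifs; exacts [hS' p, hS])
      (fun p => by split_ifs; exacts [hw' p, hw])
      (fun p P hP => by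
        rw [hrule P hP]
        split_ifs
        · rw [hrule' p P (by rwa [hScard])]
          ring
        · simp)
      (e := e) (by omega) hτpos (by
        have h1 : ∀ p : ι × κ, ρ p.1 * σ p.2 * (η - if p ∈ E then τ / (ρ p.1 * σ p.2) else 0) =
            η * (ρ p.1 * σ p.2) - if p ∈ E then τ else 0 := by
          intro p
          have := (mul_pos (hρ p.1) (hσ p.2)).ne'
          split_ifs
          · rw [mul_sub, mul_div_cancel₀ _ this, mul_comm]
          · ring
        rw [sum_congr rfl fun p _ => h1 p, sum_sub_distrib, ← mul_sum, sum_ite_mem, univ_inter,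
          sum_const, hE, nsmul_eq_mul, sub_eq_iff_eq_add, ← add_mul, add_comm, hτ]
        field_simp)
    convert this using 1
    have h2 : ∀ p : ι × κ, 2 * (if p ∈ E then S' p else S).card =
        2 * r + if p ∈ E then 2 else 0 := by
      intro p
      split_ifs
      · rw [hS'card, hScard]; ring
      · rw [hScard, add_zero]
    rw [sum_congr rfl fun p _ => h2 p, sum_add_distrib, sum_ite_mem, univ_inter, sum_const,
      sum_const, hE, card_univ, Fintype.card_prod, hn, hν, smul_eq_mul, smul_eq_mul, add_assoc, he,
      mul_comm (ν / 2), Nat.div_add_mod]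
    ring

end

/-! ### Sphere designs from real frames, and existence of real frames. -/

/-- A real frame in dimension `finrank ℝ K` is a design on the unit sphere of `K`. -/
theorem HasUnitFrame.hasSphereDesign {K : Type} [NormedDivisionRing K] [InnerProductSpace ℝ K]
    [FiniteDimensional ℝ K] {ν N : ℕ}
    (h : HasUnitFrame ℝ (Module.finrank ℝ K) ν (N / 2)) : HasSphereDesign K ν N := by
  obtain ⟨ι, _, u, w, R, hν, hR, hu, hw, hind, hsum⟩ := h
  have hδ : 0 < Module.finrank ℝ K := Module.finrank_pos
  set B := stdOrthonormalBasis ℝ K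
  have hinner : ∀ (v : K) (s : ι), inner ℝ v (B.repr.symm (WithLp.toLp 2 (u s))) =
      colInner (u s) (B.repr v) := by
    intro v s
    rw [← B.repr.inner_map_map, LinearIsometryEquiv.apply_symm_apply, PiLp.inner_apply, colInner]
    refine sum_congr rfl fun i _ => by simp
  have hnorm : ∀ v : K, colNormSq (B.repr v) = ‖v‖ ^ 2 := by
    intro v
    rw [← B.repr.norm_map v, EuclideanSpace.norm_sq_eq, colNormSq]
  refine ⟨ι, inferInstance, fun s => B.repr.symm (WithLp.toLp 2 (u s)), w,
    R * (risingFactorial ((Module.finrank ℝ K : ℝ) / 2) (N / 2) /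
      risingFactorial (1 / 2) (N / 2)), hν, ?_, fun s => ?_, hw, fun s t hst => ?_, fun l hl v => ?_⟩
  · exact mul_pos hR (div_pos (risingFactorial_pos (by positivity) _)
      (risingFactorial_pos (by norm_num) _))
  · have := hnorm (B.repr.symm (WithLp.toLp 2 (u s)))
    rw [LinearIsometryEquiv.apply_symm_apply] at this
    have h1 : ‖B.repr.symm (WithLp.toLp 2 (u s))‖ ^ 2 = 1 := this.symm.trans (hu s)
    exact (pow_eq_one_iff_of_nonneg (norm_nonneg _) two_ne_zero).1 h1
  · rw [← map_neg]
    constructor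
    · intro h
      have h := congrArg WithLp.ofLp (B.repr.symm.injective h)
      have := (hind s t hst 1 (-1) fun i => by simpa [sub_eq_zero, ← sub_eq_add_neg] using congrFun h i).1
      exact one_ne_zero this
    · intro h
      have h := congrArg WithLp.ofLp (B.repr.symm.injective h)
      have := (hind s t hst 1 1 fun i => by simpa [eq_neg_iff_add_eq_zero] using congrFun h i).1
      exact one_ne_zero this
  -- Over `ℝ` the lower moments have the ratio `(1/2)_l / (δ/2)_l`, with `δ` the real dimension of
  -- `K`, as a design requires.
  · have h1 := sum_norm_sq_pow_eq hδ u hu w R hsum (show l ≤ N / 2 by omega) (B.repr v)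
    simp only [Module.finrank_self, one_mul, Nat.cast_one, hnorm] at h1
    rw [← h1]
    refine sum_congr rfl fun s _ => ?_
    rw [hinner, Real.norm_eq_abs, sq_abs]

theorem hasUnitFrame_real_one (N : ℕ) : HasUnitFrame ℝ 1 1 N := by
  refine ⟨Unit, inferInstance, fun _ _ => 1, fun _ => 1, 1, by simp, one_pos, by simp [colNormSq],
    fun _ => one_pos, fun k l h => absurd (Subsingleton.elim k l) h, fun x => ?_⟩
  simp [colInner, colNormSq]

/-- The recursion over `ℝ` itself, with the one-point design. It makes the set defining `minDim`
nonempty, so that its infimum is attained. -/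
theorem exists_hasUnitFrame_real (d N : ℕ) : ∃ n, HasUnitFrame ℝ (d + 1) n N := by
  induction d with
  | zero => exact ⟨1, hasUnitFrame_real_one N⟩
  | succ d ih =>
    obtain ⟨n, hn⟩ := ih
    have hdes : HasSphereDesign ℝ 1 N := HasUnitFrame.hasSphereDesign (by
      rw [Module.finrank_self]
      exact hasUnitFrame_real_one _)
    exact ⟨_, hn.succ d.succ_pos hdes⟩

/-! ### Translation between unit frames and isometric embeddings. -/

section

variable {K : Type} [NormedDivisionRing K]

theorem colIndep_iff_linearIndependent {d : ℕ} (u v : Fin d → K) :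
    ColIndep u v ↔ LinearIndependent Kᵐᵒᵖ ![u, v] := by
  rw [LinearIndependent.pair_iff]
  constructor
  · intro h s t hst
    simpa using h s.unop t.unop fun i => by simpa using congrFun hst i
  · intro h a b hab
    simpa using h (MulOpposite.op a) (MulOpposite.op b) (funext fun i => by simpa using hab i)

variable [StarRing K]

theorem exists_linearMap_frameVector_eq (p : ℝ≥0∞) {d n : ℕ} (u : Fin n → Fin d → K) :
    ∃ T : ProjEmb.Ell 2 K d →ₗ[Kᵐᵒᵖ] ProjEmb.Ell p K n, ∀ k, ProjEmb.frameVector T k = u k := by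
  refine ⟨{ toFun := fun y => WithLp.toLp p fun k => colInner (u k) y
            map_add' := fun x y => ?_
            map_smul' := fun a y => ?_ }, fun k => ?_⟩
  · ext k
    simp [colInner_add]
  · ext k
    simp [colInner, sum_mul, mul_assoc]
  · ext i
    simp [ProjEmb.frameVector, colInner_single]

theorem isIsometricEmbedding_iff {d n N : ℕ} (hN : 0 < N)
    (T : ProjEmb.Ell 2 K d →ₗ[Kᵐᵒᵖ] ProjEmb.Ell ((2 * N : ℕ) : ℝ≥0∞) K n) :
    ProjEmb.IsIsometricEmbedding T ↔ ∀ x : Fin d → K,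
      ∑ k, (‖colInner (ProjEmb.frameVector T k) x‖ ^ 2) ^ N = colNormSq x ^ N := by
  have hp : 0 < ((2 * N : ℕ) : ℝ≥0∞).toReal := by
    rw [ENNReal.toReal_natCast]
    positivity
  have hnorm : ∀ y : ProjEmb.Ell 2 K d, ‖T y‖ ^ (2 * N) =
      ∑ k, (‖colInner (ProjEmb.frameVector T k) y‖ ^ 2) ^ N := by
    intro y
    rw [PiLp.norm_eq_sum hp, ENNReal.toReal_natCast, ← Real.rpow_natCast, ← Real.rpow_mul
      (sum_nonneg fun _ _ => by positivity), one_div, inv_mul_cancel₀ (by positivity),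
      Real.rpow_one]
    refine sum_congr rfl fun k _ => ?_
    rw [Real.rpow_natCast, pow_mul, ProjEmb.apply_eq_innerProd]
    rfl
  have hnorm2 : ∀ y : ProjEmb.Ell 2 K d, ‖y‖ ^ 2 = colNormSq y := by
    intro y
    rw [PiLp.norm_sq_eq_of_L2]
    rfl
  have hN2 : 2 * N ≠ 0 := by omega
  constructor
  · intro h x
    have h1 := h (WithLp.toLp 2 x)
    have h2 := hnorm (WithLp.toLp 2 x)
    rw [h1, pow_mul, hnorm2] at h2
    exact h2.symm
  · intro h y
    have : Fact (1 ≤ ((2 * N : ℕ) : ℝ≥0∞)) := ⟨by exact_mod_cast Nat.one_le_iff_ne_zero.2 hN2⟩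
    refine (pow_left_inj₀ (norm_nonneg (T y)) (norm_nonneg y) hN2).1 ?_
    rw [hnorm, pow_mul, hnorm2]
    exact h y

variable [InnerProductSpace ℝ K] [IsHurwitzAlgebra K]

theorem exists_isIsometricEmbedding_of_sum {ι : Type} [Fintype ι] {d N : ℕ} (hN : 0 < N)
    (u : ι → Fin d → K) (w : ι → ℝ) {R : ℝ} (hR : 0 < R) (hw : ∀ k, 0 < w k)
    (h : ∀ x, ∑ k, w k * (‖colInner (u k) x‖ ^ 2) ^ N = R * colNormSq x ^ N) :
    ∃ T : ProjEmb.Ell 2 K d →ₗ[Kᵐᵒᵖ] ProjEmb.Ell ((2 * N : ℕ) : ℝ≥0∞) K (Fintype.card ι),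
      ProjEmb.IsIsometricEmbedding T ∧ ∃ (e : Fin (Fintype.card ι) ≃ ι) (r : ι → ℝ),
        (∀ k, r k ≠ 0) ∧ ∀ k, ProjEmb.frameVector T k = r (e k) • u (e k) := by
  let e := (Fintype.equivFin ι).symm
  have hpos : ∀ k, 0 < w k / R := fun k => div_pos (hw k) hR
  -- Scaling a column by the `2N`-th root of its normalized weight absorbs the weight.
  set r : ι → ℝ := fun k => (w k / R) ^ ((2 * N : ℕ) : ℝ)⁻¹ with hr
  have hr0 : ∀ k, 0 < r k := fun k => Real.rpow_pos_of_pos (hpos k) _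
  have hrN : ∀ k, (r k ^ 2) ^ N = w k / R := fun k => by
    rw [← pow_mul]
    exact Real.rpow_inv_natCast_pow (hpos k).le (by omega)
  obtain ⟨T, hT⟩ := exists_linearMap_frameVector_eq ((2 * N : ℕ) : ℝ≥0∞)
    fun k => r (e k) • u (e k)
  refine ⟨T, (isIsometricEmbedding_iff hN T).2 fun x => ?_, e, r, fun k => (hr0 k).ne', hT⟩
  simp only [hT, colInner_smul_left, norm_smul, mul_pow, Real.norm_eq_abs, sq_abs, hrN]
  rw [e.sum_comp fun k => w k / R * (‖colInner (u k) x‖ ^ 2) ^ N]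
  have := h x
  simp only [div_mul_eq_mul_div]
  rw [← sum_div, this]
  field_simp

theorem HasUnitFrame.exists_isIrreducible {d n N : ℕ} (hN : 0 < N) (h : HasUnitFrame K d n N) :
    ∃ T : ProjEmb.Ell 2 K d →ₗ[Kᵐᵒᵖ] ProjEmb.Ell ((2 * N : ℕ) : ℝ≥0∞) K n,
      ProjEmb.IsIsometricEmbedding T ∧ ProjEmb.IsIrreducible T := by
  obtain ⟨ι, _, u, w, R, rfl, hR, hu, hw, hind, hsum⟩ := h
  obtain ⟨T, hT, e, r, hr, hTr⟩ := exists_isIsometricEmbedding_of_sum hN u w hR hw hsum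
  refine ⟨T, hT, fun k h0 => ?_, fun i k hik => ?_⟩
  · have hu0 : u (e k) = 0 := by
      rw [hTr] at h0
      exact (smul_eq_zero.1 h0).resolve_left (hr _)
    have := hu (e k)
    simp [hu0, colNormSq] at this
  · rw [← colIndep_iff_linearIndependent, hTr, hTr]
    exact (hind _ _ (e.injective.ne hik)).smul (hr _) (hr _)

theorem hasUnitFrame_of_isIrreducible {d n N : ℕ} (hN : 0 < N)
    {T : ProjEmb.Ell 2 K d →ₗ[Kᵐᵒᵖ] ProjEmb.Ell ((2 * N : ℕ) : ℝ≥0∞) K n}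
    (hT : ProjEmb.IsIsometricEmbedding T) (hirr : ProjEmb.IsIrreducible T) :
    HasUnitFrame K d n N := by
  have := hasUnitFrame_of_ne_zero (N := N) (ProjEmb.frameVector T) (fun _ => 1) one_pos hirr.1
    (fun _ => one_pos) (fun k l hkl => (colIndep_iff_linearIndependent _ _).2 (hirr.2 k l hkl))
    fun x => by simpa using (isIsometricEmbedding_iff hN T).1 hT x
  simpa using this

end

/-! ### Minimal real embeddings and the final recursion. -/

/-- An isometric embedding of minimal dimension is irreducible. -/
theorem isIrreducible_of_forall_le {d n N : ℕ} (hN : 0 < N)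
    {T : ProjEmb.Ell 2 ℝ d →ₗ[ℝᵐᵒᵖ] ProjEmb.Ell ((2 * N : ℕ) : ℝ≥0∞) ℝ n}
    (hT : ProjEmb.IsIsometricEmbedding T)
    (hmin : ∀ n', (∃ T' : ProjEmb.Ell 2 ℝ d →ₗ[ℝᵐᵒᵖ] ProjEmb.Ell ((2 * N : ℕ) : ℝ≥0∞) ℝ n',
      ProjEmb.IsIsometricEmbedding T') → n ≤ n') : ProjEmb.IsIrreducible T := by
  have hsum := (isIsometricEmbedding_iff hN T).1 hT
  set u := ProjEmb.frameVector T
  have hcard : ∀ k : Fin n, Fintype.card {i // i ≠ k} < n := by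
    intro k
    have := k.pos
    rw [Fintype.card_subtype_compl, Fintype.card_fin, Fintype.card_subtype_eq]
    omega
  -- A zero column contributes nothing, since `N > 0`, and could be dropped.
  have hne : ∀ k, u k ≠ 0 := by
    intro k hk
    obtain ⟨T', hT', -⟩ := exists_isIsometricEmbedding_of_sum hN
      (fun i : {i // i ≠ k} => u i) (fun _ => 1) one_pos (fun _ => one_pos) fun x => by
        rw [one_mul, ← hsum x, Fintype.sum_eq_add_sum_subtype_ne _ k, hk, colInner_zero_left]
        simp [hN.ne']
    exact absurd (hmin _ ⟨T', hT'⟩) (hcard k).not_ge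
  refine ⟨hne, fun i k hik => ?_⟩
  rw [LinearIndependent.pair_iff' (hne i)]
  intro a ha
  have hak : u k = a.unop • u i := by
    rw [show u k = a • u i from ha.symm]
    ext j
    simp [mul_comm]
  -- If `u k` is `a` times `u i`, its term is `a ^ (2N)` times that of `u i`; the two merge into one
  -- column of weight `1 + a ^ (2N)`, contradicting minimality.
  obtain ⟨T', hT', -⟩ := exists_isIsometricEmbedding_of_sum hN
    (fun j : {j // j ≠ k} => u j) (fun j => if (j : Fin n) = i then 1 + (a.unop ^ 2) ^ N else 1)
    one_pos (fun j => by split_ifs <;> positivity) fun x => by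
      have h1 : ∀ j : {j // j ≠ k}, (if (j : Fin n) = i then 1 + (a.unop ^ 2) ^ N else 1) *
          (‖colInner (u j) x‖ ^ 2) ^ N = (‖colInner (u j) x‖ ^ 2) ^ N +
          if j = ⟨i, hik⟩ then (a.unop ^ 2) ^ N * (‖colInner (u i) x‖ ^ 2) ^ N else 0 := by
        rintro ⟨j, hj⟩
        simp only [Subtype.mk.injEq]
        split_ifs with h
        · subst h; ring
        · ring
      rw [one_mul, ← hsum x, Fintype.sum_eq_add_sum_subtype_ne _ k,
        sum_congr rfl fun j _ => h1 j, sum_add_distrib, sum_ite_eq', if_pos (mem_univ _), hak,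
        colInner_smul_left, norm_smul, mul_pow, mul_pow, Real.norm_eq_abs a.unop,
        sq_abs a.unop]
      ring
  exact absurd (hmin _ ⟨T', hT'⟩) (hcard k).not_ge

theorem hasUnitFrame_minDim {d N : ℕ} (hd : 0 < d) (hN : 0 < N) :
    HasUnitFrame ℝ d (ProjEmb.minDim ℝ d (2 * N)) N := by
  obtain ⟨d, rfl⟩ : ∃ d', d = d' + 1 := ⟨d - 1, by omega⟩
  have hne : {n : ℕ | ∃ T : ProjEmb.Ell 2 ℝ (d + 1) →ₗ[ℝᵐᵒᵖ]
      ProjEmb.Ell ((2 * N : ℕ) : ℝ≥0∞) ℝ n, ProjEmb.IsIsometricEmbedding T}.Nonempty := by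
    obtain ⟨n, hn⟩ := exists_hasUnitFrame_real d N
    obtain ⟨T, hT, -⟩ := hn.exists_isIrreducible hN
    exact ⟨n, T, hT⟩
  obtain ⟨T, hT⟩ := Nat.sInf_mem hne
  exact hasUnitFrame_of_isIrreducible hN hT
    (isIrreducible_of_forall_le hN hT fun n' h => Nat.sInf_le h)

/-- The recursion from dimension `m - 1` to dimension `m` over any of the three algebras. -/
theorem exists_isIrreducible_newDim {K : Type} [NormedDivisionRing K] [StarRing K]
    [InnerProductSpace ℝ K] [IsHurwitzAlgebra K] [FiniteDimensional ℝ K] {m p n : ℕ} (hm : 2 ≤ m)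
    (hp : 4 ≤ p) (hpe : Even p) (T : ProjEmb.Ell 2 K (m - 1) →ₗ[Kᵐᵒᵖ] ProjEmb.Ell p K n)
    (hT : ProjEmb.IsIsometricEmbedding T) (hirr : ProjEmb.IsIrreducible T) :
    ∃ T' : ProjEmb.Ell 2 K m →ₗ[Kᵐᵒᵖ] ProjEmb.Ell p K (ProjEmb.newDim K p n),
      ProjEmb.IsIsometricEmbedding T' ∧ ProjEmb.IsIrreducible T' := by
  obtain ⟨N, rfl⟩ : ∃ N, p = 2 * N := ⟨p / 2, by obtain ⟨k, rfl⟩ := hpe; omega⟩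
  obtain ⟨d, rfl⟩ : ∃ d, m = d + 1 := ⟨m - 1, by omega⟩
  have hdes : HasSphereDesign K (ProjEmb.nu K (2 * N)) N := by
    refine HasUnitFrame.hasSphereDesign ?_
    rw [ProjEmb.nu, show 2 * N / 4 = N / 2 by omega]
    exact hasUnitFrame_minDim Module.finrank_pos (by omega)
  have hframe := hasUnitFrame_of_isIrreducible (by omega) hT hirr
  have := (hframe.succ (by omega) hdes).exists_isIrreducible (by omega)
  have hdim : ProjEmb.newDim K (2 * N) n = if N % 2 = 1 then ProjEmb.nu K (2 * N) * (N + 1) * n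
      else ProjEmb.nu K (2 * N) * (N * n + 1) := by
    rw [ProjEmb.newDim, Nat.mul_div_cancel_left _ two_pos]
    exact if_congr (by omega) rfl rfl
  rwa [hdim]

theorem theorem1p4 (m p n : ℕ) (hm : 2 ≤ m) (hp : 4 ≤ p) (hpe : Even p) :
    (∀ T : ProjEmb.Ell 2 ℝ (m - 1) →ₗ[ℝᵐᵒᵖ] ProjEmb.Ell p ℝ n,
      ProjEmb.IsIsometricEmbedding T → ProjEmb.IsIrreducible T →
      ∃ T' : ProjEmb.Ell 2 ℝ m →ₗ[ℝᵐᵒᵖ] ProjEmb.Ell p ℝ (ProjEmb.newDim ℝ p n),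
        ProjEmb.IsIsometricEmbedding T' ∧ ProjEmb.IsIrreducible T') ∧
    (∀ T : ProjEmb.Ell 2 ℂ (m - 1) →ₗ[ℂᵐᵒᵖ] ProjEmb.Ell p ℂ n,
      ProjEmb.IsIsometricEmbedding T → ProjEmb.IsIrreducible T →
      ∃ T' : ProjEmb.Ell 2 ℂ m →ₗ[ℂᵐᵒᵖ] ProjEmb.Ell p ℂ (ProjEmb.newDim ℂ p n),
        ProjEmb.IsIsometricEmbedding T' ∧ ProjEmb.IsIrreducible T') ∧
    (∀ T : ProjEmb.Ell 2 ℍ[ℝ] (m - 1) →ₗ[ℍ[ℝ]ᵐᵒᵖ] ProjEmb.Ell p ℍ[ℝ] n,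
      ProjEmb.IsIsometricEmbedding T → ProjEmb.IsIrreducible T →
      ∃ T' : ProjEmb.Ell 2 ℍ[ℝ] m →ₗ[ℍ[ℝ]ᵐᵒᵖ] ProjEmb.Ell p ℍ[ℝ] (ProjEmb.newDim ℍ[ℝ] p n),
        ProjEmb.IsIsometricEmbedding T' ∧ ProjEmb.IsIrreducible T') :=
  ⟨fun T h1 h2 => exists_isIrreducible_newDim (K := ℝ) hm hp hpe T h1 h2,
    fun T h1 h2 => exists_isIrreducible_newDim (K := ℂ) hm hp hpe T h1 h2,
    fun T h1 h2 => exists_isIrreducible_newDim (K := ℍ[ℝ]) hm hp hpe T h1 h2⟩
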